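/- Let $d\in\mathbb N$, let $b\in\mathcal C^\infty(\mathbb R^d,\mathbb R^d)$ be such that all its partial derivatives of every order at least $1$ are bounded, and let $\Sigma$ be a constant real symmetric positive semidefinite $d\times d$ matrix (possibly degenerate). Let $W$ be a standard Brownian motion on $\mathbb R^d$ and consider $$\mathrm dZ_t=b(Z_t)\,\mathrm dt+\Sigma\,\mathrm dW_t .\tag{1}$$ Let $(P_t)_{t\ge 0}$ be the associated Markov semigroup: $P_tf(z)=\mathbb E(f(Z_t)\mid Z_0=z)$ for functions $f$, and $\nu P_t$ is the law of $Z_t$ when $Z_0\sim\nu$ is independent of $W$. Let $M$ be a real symmetric positive definite $d\times d$ matrix and $\rho\in\mathbb R$. Write $\|x\|_M=\sqrt{x\cdot Mx}$, let $J_b(z)=(\partial_{z_j}b_i(z))_{i,j}$, and for square matrices let $A\le B$ mean $x\cdot Ax\le x\cdot Bx$ for all $x$. For $r\in[1,\infty]$ and probability measures $\nu,\mu$ on $\mathbb R^d$ let $$\mathcal W_{M,r}(\nu,\mu)=\inf_{\pi}\big\|(z,y)\mapsto\|z-y\|_M\big\|_{L^r(\pi)}\in[0,\infty],$$ the infimum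 being over all couplings $\pi$ of $\nu$ and $\mu$. For $f:\mathbb R^d\to\mathbb R$ let $$\|\nabla f(z)\|_{M^{-1}}=\lim_{r\downarrow0}\ \sup_{0<\|z-y\|_M\le r}\frac{|f(z)-f(y)|}{\|y-z\|_M},\qquad \|\nabla f\|_{M^{-1},\infty}=\sup_{z\ne y}\frac{|f(z)-f(y)|}{\|y-z\|_M}$$ (suprema over the empty set being $0$), and let $\mathcal C_{b,L}(\mathbb R^d)$ be the set of bounded Lipschitz functions $\mathbb R^d\to\mathbb R$. Then the following are equivalent: (i) $\mathrm{Cont}_R(M,\rho)$: $\;MJ_b(z)\le-\rho M$ for all $z\in\mathbb R^d$. (ii) For all $z_1,z_2\in\mathbb R^d$, if $Z_1,Z_2$ are the solutions of (1) driven by the same Brownian motion $W$ with $Z_{1,0}=z_1$, $Z_{2,0}=z_2$, then almost surely, for all $t\ge0$, $\|Z_{1,t}-Z_{2,t}\|_M\le e^{-\rho t}\|z_1-z_2\|_M$. (iii) For all probability measures $\nu,\mu$ on $\mathbb R^d$ and $t\ge0$, $\mathcal W_{M,\infty}(\nu P_t,\mu P_t)\le e^{-\rho t}\,\mathcal W_{M,\infty}(\nu,\mu)$.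 (iv) For all probability measures $\nu,\mu$ on $\mathbb R^d$ and $t\ge0$, $\mathcal W_{M,1}(\nu P_t,\mu P_t)\le e^{-\rho t}\,\mathcal W_{M,1}(\nu,\mu)$. (v) For all $f\in\mathcal C_{b,L}(\mathbb R^d)$, $t\ge0$ and $z\in\mathbb R^d$, $\|\nabla P_tf(z)\|_{M^{-1}}\le e^{-\rho t}\,P_t\big(\|\nabla f\|_{M^{-1}}\big)(z)$. (vi) For all $f\in\mathcal C_{b,L}(\mathbb R^d)$ and $t\ge0$, $\|\nabla P_tf\|_{M^{-1},\infty}\le e^{-\rho t}\,\|\nabla f\|_{M^{-1},\infty}$. -/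

import Mathlib

open MeasureTheory ProbabilityTheory Matrix
open scoped NNReal ENNReal

noncomputable section

namespace DiffusionContraction

/-- A standard Brownian motion on `ℝ^d`: the coordinates are independent standard real Brownian
motions started at `0` (with almost surely continuous paths). -/
structure IsBrownian {Ω : Type*} [MeasurableSpace Ω] {d : ℕ}
    (W : ℝ≥0 → Ω → EuclideanSpace ℝ (Fin d)) (P : Measure Ω) : Prop where
  coord : ∀ i, IsBrownianReal (fun t ω => W t ω i) P
  indep : iIndepFun (fun (i : Fin d) (ω : Ω) (t : ℝ≥0) => W t ω i) P

/-- The drift is smooth and all its derivatives of order at least one are bounded. -/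
structure IsAdmissibleDrift {d : ℕ} (b : EuclideanSpace ℝ (Fin d) → EuclideanSpace ℝ (Fin d)) :
    Prop where
  smooth : ContDiff ℝ (⊤ : ℕ∞) b
  bounded : ∀ n : ℕ, 1 ≤ n → ∃ C : ℝ, ∀ z, ‖iteratedFDeriv ℝ n b z‖ ≤ C

/-- The continuous path `x` solves `x t = z + ∫₀ᵗ b (x s) ds + S (w t)` for all `t ≥ 0`. -/
def IsPathSolution {d : ℕ} (b : EuclideanSpace ℝ (Fin d) → EuclideanSpace ℝ (Fin d))
    (S : Matrix (Fin d) (Fin d) ℝ) (w : ℝ≥0 → EuclideanSpace ℝ (Fin d))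
    (z : EuclideanSpace ℝ (Fin d)) (x : ℝ≥0 → EuclideanSpace ℝ (Fin d)) : Prop :=
  Continuous x ∧
    ∀ t : ℝ≥0, x t =
      z + (∫ s in (0 : ℝ)..t, b (x s.toNNReal)) + WithLp.toLp 2 (S *ᵥ (w t).ofLp)

/-- `Z` is a solution of `dZ = b(Z) dt + S dW`, `Z 0 = z`. The noise is additive, so the
stochastic equation is an integral equation for almost every path. For a Lipschitz drift its
solution is a deterministic, non-anticipating continuous functional of the path of `W`; adaptedness
is therefore automatic and need not be imposed. -/
def IsSolution {Ω : Type*} [MeasurableSpace Ω] {d : ℕ}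
    (b : EuclideanSpace ℝ (Fin d) → EuclideanSpace ℝ (Fin d))
    (S : Matrix (Fin d) (Fin d) ℝ) (W : ℝ≥0 → Ω → EuclideanSpace ℝ (Fin d)) (P : Measure Ω)
    (z : EuclideanSpace ℝ (Fin d)) (Z : ℝ≥0 → Ω → EuclideanSpace ℝ (Fin d)) : Prop :=
  ∀ᵐ ω ∂P, IsPathSolution b S (fun t => W t ω) z (fun t => Z t ω)

open Classical in
/-- The solution started at `z` (for a Lipschitz drift it exists and is unique along every
continuous path of `W`; the value on the other paths is irrelevant). -/
def solution {Ω : Type*} {d : ℕ} (b : EuclideanSpace ℝ (Fin d) → EuclideanSpace ℝ (Fin d))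
    (S : Matrix (Fin d) (Fin d) ℝ) (W : ℝ≥0 → Ω → EuclideanSpace ℝ (Fin d))
    (z : EuclideanSpace ℝ (Fin d)) (t : ℝ≥0) (ω : Ω) : EuclideanSpace ℝ (Fin d) :=
  if h : ∃ x, IsPathSolution b S (fun t => W t ω) z x then h.choose t else z

/-- The transition probability `δ_z P_t`: the law at time `t` of the solution started at `z`. -/
def transition {Ω : Type*} [MeasurableSpace Ω] {d : ℕ}
    (b : EuclideanSpace ℝ (Fin d) → EuclideanSpace ℝ (Fin d))
    (S : Matrix (Fin d) (Fin d) ℝ) (W : ℝ≥0 → Ω → EuclideanSpace ℝ (Fin d)) (P : Measure Ω)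
    (t : ℝ≥0) (z : EuclideanSpace ℝ (Fin d)) : Measure (EuclideanSpace ℝ (Fin d)) :=
  P.map (solution b S W z t)

/-- The semigroup on functions, `P_t f (z) = E [f (Z_t) | Z_0 = z]`. -/
def semigroup {Ω : Type*} [MeasurableSpace Ω] {d : ℕ}
    (b : EuclideanSpace ℝ (Fin d) → EuclideanSpace ℝ (Fin d))
    (S : Matrix (Fin d) (Fin d) ℝ) (W : ℝ≥0 → Ω → EuclideanSpace ℝ (Fin d)) (P : Measure Ω)
    (t : ℝ≥0) (f : EuclideanSpace ℝ (Fin d) → ℝ) (z : EuclideanSpace ℝ (Fin d)) : ℝ :=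
  ∫ y, f y ∂(transition b S W P t z)

/-- The semigroup acting on `[0, ∞]`-valued functions. -/
def semigroupENN {Ω : Type*} [MeasurableSpace Ω] {d : ℕ}
    (b : EuclideanSpace ℝ (Fin d) → EuclideanSpace ℝ (Fin d))
    (S : Matrix (Fin d) (Fin d) ℝ) (W : ℝ≥0 → Ω → EuclideanSpace ℝ (Fin d)) (P : Measure Ω)
    (t : ℝ≥0) (f : EuclideanSpace ℝ (Fin d) → ℝ≥0∞) (z : EuclideanSpace ℝ (Fin d)) : ℝ≥0∞ :=
  ∫⁻ y, f y ∂(transition b S W P t z)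

/-- The semigroup on measures: `ν P_t` is the mixture `∫ δ_z P_t ν(dz)`. -/
def evolve {Ω : Type*} [MeasurableSpace Ω] {d : ℕ}
    (b : EuclideanSpace ℝ (Fin d) → EuclideanSpace ℝ (Fin d))
    (S : Matrix (Fin d) (Fin d) ℝ) (W : ℝ≥0 → Ω → EuclideanSpace ℝ (Fin d)) (P : Measure Ω)
    (t : ℝ≥0) (ν : Measure (EuclideanSpace ℝ (Fin d))) : Measure (EuclideanSpace ℝ (Fin d)) :=
  ν.bind (transition b S W P t)

/-- The norm `‖x‖_M = √(x · M x)`. -/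
def normM {d : ℕ} (M : Matrix (Fin d) (Fin d) ℝ) (x : EuclideanSpace ℝ (Fin d)) : ℝ :=
  √(x.ofLp ⬝ᵥ M *ᵥ x.ofLp)

/-- `A ≤ B` in the sense of quadratic forms, for not necessarily symmetric matrices. -/
def QuadLE {d : ℕ} (A B : Matrix (Fin d) (Fin d) ℝ) : Prop :=
  ∀ x : Fin d → ℝ, x ⬝ᵥ A *ᵥ x ≤ x ⬝ᵥ B *ᵥ x

/-- The Jacobian matrix `(∂_j b_i (z))_{i j}`. -/
def jacobian {d : ℕ} (b : EuclideanSpace ℝ (Fin d) → EuclideanSpace ℝ (Fin d))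
    (z : EuclideanSpace ℝ (Fin d)) : Matrix (Fin d) (Fin d) ℝ :=
  Matrix.of fun i j => (fderiv ℝ b z (EuclideanSpace.single j 1)) i

/-- The condition `Cont_R(M, ρ)`: `M J_b(z) ≤ -ρ M` for all `z`. -/
def ContR {d : ℕ} (b : EuclideanSpace ℝ (Fin d) → EuclideanSpace ℝ (Fin d))
    (M : Matrix (Fin d) (Fin d) ℝ) (ρ : ℝ) : Prop :=
  ∀ z, QuadLE (M * jacobian b z) (-ρ • M)

/-- The set of couplings (transference plans) of `ν` and `μ`. -/
def couplings {d : ℕ} (ν μ : Measure (EuclideanSpace ℝ (Fin d))) :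
    Set (Measure (EuclideanSpace ℝ (Fin d) × EuclideanSpace ℝ (Fin d))) :=
  {π | π.map Prod.fst = ν ∧ π.map Prod.snd = μ}

/-- The Wasserstein distance `W_{M,r}`, with values in `[0, ∞]`. -/
def wasserstein {d : ℕ} (M : Matrix (Fin d) (Fin d) ℝ) (r : ℝ≥0∞)
    (ν μ : Measure (EuclideanSpace ℝ (Fin d))) : ℝ≥0∞ :=
  ⨅ π ∈ couplings ν μ, eLpNorm (fun p => normM M (p.1 - p.2)) r π

/-- The slope `|f z - f y| / ‖y - z‖_M`. -/
def slopeM {d : ℕ} (M : Matrix (Fin d) (Fin d) ℝ) (f : EuclideanSpace ℝ (Fin d) → ℝ)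
    (z y : EuclideanSpace ℝ (Fin d)) : ℝ≥0∞ :=
  ENNReal.ofReal (|f z - f y| / normM M (y - z))

/-- `‖∇f(z)‖_{M⁻¹}`, the local Lipschitz constant of `f` at `z`: the limit as `r ↓ 0` of the
supremum of the slopes over `0 < ‖z - y‖_M ≤ r`. The supremum is monotone in `r`, so that the limit
is the infimum over `r > 0`. -/
def gradNorm {d : ℕ} (M : Matrix (Fin d) (Fin d) ℝ) (f : EuclideanSpace ℝ (Fin d) → ℝ)
    (z : EuclideanSpace ℝ (Fin d)) : ℝ≥0∞ :=
  ⨅ (r : ℝ) (_ : 0 < r), ⨆ (y : EuclideanSpace ℝ (Fin d))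
    (_ : 0 < normM M (z - y) ∧ normM M (z - y) ≤ r), slopeM M f z y

/-- `‖∇f‖_{M⁻¹,∞}`, the global Lipschitz constant of `f` for `‖·‖_M`. -/
def gradNormSup {d : ℕ} (M : Matrix (Fin d) (Fin d) ℝ) (f : EuclideanSpace ℝ (Fin d) → ℝ) :
    ℝ≥0∞ :=
  ⨆ (z : EuclideanSpace ℝ (Fin d)) (y : EuclideanSpace ℝ (Fin d)) (_ : z ≠ y), slopeM M f z y

/-- Bounded Lipschitz functions. -/
def IsBoundedLipschitz {d : ℕ} (f : EuclideanSpace ℝ (Fin d) → ℝ) : Prop :=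
  (∃ C : ℝ, ∀ z, |f z| ≤ C) ∧ ∃ K : ℝ≥0, LipschitzWith K f

end DiffusionContraction

end

open DiffusionContraction

open Filter Topology Set
open scoped InnerProductSpace

/-!
The noise is additive, so it cancels in the difference of two solutions driven by the same path:
`Z₁ - Z₂` is differentiable with derivative `b(Z₁) - b(Z₂)`. The condition `Cont_R(M, ρ)` is the
infinitesimal form of the one-sided Lipschitz bound `⟨z - y, b(z) - b(y)⟩_M ≤ -ρ ‖z - y‖_M²`, so
that Grönwall's inequality for `‖Z₁ - Z₂‖_M²` gives (i) ⇒ (ii). Pushing a coupling, or the slopes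
of a test function, forward along the flow with common noise gives (ii) ⇒ (iii), (iv), (v), and
each of these implies (vi). Conversely, (vi) for truncated linear functionals yields
`‖E(Z₁ - Z₂)‖_M ≤ e^{-ρt} ‖z₁ - z₂‖_M`. The two sides agree at `t = 0`, and comparing their right
derivatives there gives back the one-sided Lipschitz bound.
-/

namespace DiffusionContraction

section DrivenPath

theorem intervalIntegrable_comp_toNNReal {E : Type*} [NormedAddCommGroup E] {f : ℝ≥0 → E}
    (hf : Continuous f) (s t : ℝ) :
    IntervalIntegrable (fun r : ℝ => f r.toNNReal) volume s t :=
  (hf.comp continuous_real_toNNReal).intervalIntegrable s t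

variable {E : Type*} [NormedAddCommGroup E] [NormedSpace ℝ E] {b : E → E} {K : ℝ≥0}
  {γ : ℝ≥0 → E} {z z₁ z₂ : E} {x₁ x₂ : ℝ≥0 → E}

/-- The continuous path `x` solves `x t = z + ∫₀ᵗ b (x s) ds + γ t` for all `t ≥ 0`. The driving
path `γ` need not be differentiable, so this is the meaning of `dx = b(x) dt + dγ`, `x 0 = z`. -/
def IsDrivenPath (b : E → E) (γ : ℝ≥0 → E) (z : E) (x : ℝ≥0 → E) : Prop :=
  Continuous x ∧ ∀ t : ℝ≥0, x t = z + (∫ s in (0 : ℝ)..t, b (x s.toNNReal)) + γ t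

theorem continuous_integral_toNNReal {f : ℝ≥0 → E} (hf : Continuous f) :
    Continuous fun t : ℝ≥0 => ∫ s in (0 : ℝ)..t, f s.toNNReal :=
  (intervalIntegral.continuous_primitive (intervalIntegrable_comp_toNNReal hf) 0).comp
    NNReal.continuous_coe

namespace IsDrivenPath

theorem sub_eq (hb : Continuous b) (h₁ : IsDrivenPath b γ z₁ x₁) (h₂ : IsDrivenPath b γ z₂ x₂)
    (t : ℝ≥0) :
    x₁ t - x₂ t = (z₁ - z₂) + ∫ s in (0 : ℝ)..t, (b (x₁ s.toNNReal) - b (x₂ s.toNNReal)) := by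
  have hinteg : ∀ {x : ℝ≥0 → E}, Continuous x →
      IntervalIntegrable (fun s : ℝ => b (x s.toNNReal)) volume 0 t := fun hx =>
    intervalIntegrable_comp_toNNReal (hb.comp hx) 0 t
  rw [h₁.2 t, h₂.2 t, intervalIntegral.integral_sub (hinteg h₁.1) (hinteg h₂.1)]
  abel

theorem sub_zero (hb : Continuous b) (h₁ : IsDrivenPath b γ z₁ x₁)
    (h₂ : IsDrivenPath b γ z₂ x₂) : x₁ 0 - x₂ 0 = z₁ - z₂ := by
  simpa using h₁.sub_eq hb h₂ 0

theorem continuous_sub (h₁ : IsDrivenPath b γ z₁ x₁) (h₂ : IsDrivenPath b γ z₂ x₂) :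
    Continuous fun s : ℝ => x₁ s.toNNReal - x₂ s.toNNReal :=
  (h₁.1.comp continuous_real_toNNReal).sub (h₂.1.comp continuous_real_toNNReal)

theorem hasDerivWithinAt_sub [CompleteSpace E] (hb : Continuous b) (h₁ : IsDrivenPath b γ z₁ x₁)
    (h₂ : IsDrivenPath b γ z₂ x₂) {s : ℝ} (hs : 0 ≤ s) :
    HasDerivWithinAt (fun s : ℝ => x₁ s.toNNReal - x₂ s.toNNReal)
      (b (x₁ s.toNNReal) - b (x₂ s.toNNReal)) (Ici s) s := by
  have hcont : Continuous fun s : ℝ => b (x₁ s.toNNReal) - b (x₂ s.toNNReal) :=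
    ((hb.comp h₁.1).sub (hb.comp h₂.1)).comp continuous_real_toNNReal
  have hsub : ∀ r ∈ Ici s, x₁ r.toNNReal - x₂ r.toNNReal
      = z₁ - z₂ + ∫ s in (0 : ℝ)..r, (b (x₁ s.toNNReal) - b (x₂ s.toNNReal)) := fun r hr => by
    rw [h₁.sub_eq hb h₂, Real.coe_toNNReal _ (hs.trans hr)]
  exact (((hcont.integral_hasStrictDerivAt 0 s).hasDerivAt.hasDerivWithinAt).const_add
    (z₁ - z₂)).congr hsub (hsub s self_mem_Ici)

theorem norm_sub_le [CompleteSpace E] (hb : LipschitzWith K b) (h₁ : IsDrivenPath b γ z₁ x₁)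
    (h₂ : IsDrivenPath b γ z₂ x₂) (t : ℝ≥0) : ‖x₁ t - x₂ t‖ ≤ Real.exp (K * t) * ‖z₁ - z₂‖ := by
  have h := norm_le_gronwallBound_of_norm_deriv_right_le (K := K) (ε := 0) (δ := ‖z₁ - z₂‖)
    (a := 0) (b := t) (h₁.continuous_sub h₂).continuousOn
    (fun s hs => h₁.hasDerivWithinAt_sub hb.continuous h₂ hs.1)
    (by simpa using (congrArg norm (h₁.sub_zero hb.continuous h₂)).le)
    (fun s _ => by simpa using hb.norm_sub_le _ _) t ⟨t.2, le_rfl⟩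
  simpa [gronwallBound_ε0, mul_comm] using h

theorem eq [CompleteSpace E] (hb : LipschitzWith K b) (h₁ : IsDrivenPath b γ z x₁)
    (h₂ : IsDrivenPath b γ z x₂) : x₁ = x₂ := by
  funext t
  simpa [sub_eq_zero] using h₁.norm_sub_le hb h₂ t

end IsDrivenPath

/-- The Picard iterates of the integral equation defining `IsDrivenPath`. -/
noncomputable def picardIter (b : E → E) (γ : ℝ≥0 → E) (z : E) : ℕ → ℝ≥0 → E
  | 0 => fun t => z + γ t
  | n + 1 => fun t => z + (∫ s in (0 : ℝ)..t, b (picardIter b γ z n s.toNNReal)) + γ t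

/-- The flow of `dx = b(x) dt + dγ`: the limit of the Picard iterates, written as a telescoping
series so that their convergence is an instance of the Weierstrass M-test. -/
noncomputable def flow (b : E → E) (γ : ℝ≥0 → E) (z : E) (t : ℝ≥0) : E :=
  picardIter b γ z 0 t + ∑' n, (picardIter b γ z (n + 1) t - picardIter b γ z n t)

theorem continuous_picardIter (hb : Continuous b) (hγ : Continuous γ) (z : E) (n : ℕ) :
    Continuous (picardIter b γ z n) := by
  induction n with
  | zero => exact hγ.const_add z
  | succ n ih => exact ((continuous_integral_toNNReal (hb.comp ih)).const_add z).add hγ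

theorem picardIter_succ_sub (hb : Continuous b) (hγ : Continuous γ) (z : E) (n : ℕ) (t : ℝ≥0) :
    picardIter b γ z (n + 2) t - picardIter b γ z (n + 1) t = ∫ s in (0 : ℝ)..t,
      (b (picardIter b γ z (n + 1) s.toNNReal) - b (picardIter b γ z n s.toNNReal)) := by
  have hinteg : ∀ m, IntervalIntegrable (fun s : ℝ => b (picardIter b γ z m s.toNNReal))
      volume 0 t := fun m =>
    intervalIntegrable_comp_toNNReal (hb.comp (continuous_picardIter hb hγ z m)) 0 t
  rw [intervalIntegral.integral_sub (hinteg _) (hinteg _)]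
  simp [picardIter]

theorem integral_mul_mul_pow_div_factorial (K t : ℝ) (n : ℕ) :
    ∫ s in (0 : ℝ)..t, K * ((K * s) ^ n / n.factorial) = (K * t) ^ (n + 1) / (n + 1).factorial := by
  simp only [mul_pow, mul_div_assoc, intervalIntegral.integral_const_mul,
    intervalIntegral.integral_div, integral_pow, Nat.factorial_succ,
    zero_pow n.succ_ne_zero, Nat.cast_mul, Nat.cast_succ]
  field_simp
  ring

theorem norm_picardIter_succ_sub_le (hb : LipschitzWith K b) (hγ : Continuous γ) {T : ℝ≥0} {C : ℝ}
    (hC : ∀ t ≤ T, ‖picardIter b γ z 1 t - picardIter b γ z 0 t‖ ≤ C) (n : ℕ) {t : ℝ≥0}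
    (ht : t ≤ T) :
    ‖picardIter b γ z (n + 1) t - picardIter b γ z n t‖ ≤ C * ((K * t) ^ n / n.factorial) := by
  induction n generalizing t with
  | zero => simpa using hC t ht
  | succ n ih =>
    rw [picardIter_succ_sub hb.continuous hγ, ← integral_mul_mul_pow_div_factorial,
      ← intervalIntegral.integral_const_mul]
    refine intervalIntegral.norm_integral_le_of_norm_le t.2 (ae_of_all _ fun s hs => ?_)
      ((by fun_prop : Continuous _).intervalIntegrable _ _)
    have hsT : s.toNNReal ≤ T := (Real.toNNReal_le_iff_le_coe.2 hs.2).trans ht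
    calc ‖b (picardIter b γ z (n + 1) s.toNNReal) - b (picardIter b γ z n s.toNNReal)‖
        ≤ K * ‖picardIter b γ z (n + 1) s.toNNReal - picardIter b γ z n s.toNNReal‖ :=
          hb.norm_sub_le _ _
      _ ≤ K * (C * ((K * s.toNNReal) ^ n / n.factorial)) := by gcongr; exact ih hsT
      _ = C * (K * ((K * s) ^ n / n.factorial)) := by rw [Real.coe_toNNReal _ hs.1.le]; ring

theorem tendstoUniformlyOn_picardIter [CompleteSpace E] (hb : LipschitzWith K b)
    (hγ : Continuous γ) (z : E) (T : ℝ≥0) :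
    TendstoUniformlyOn (picardIter b γ z) (flow b γ z) atTop (Iic T) := by
  have hcont := continuous_picardIter hb.continuous hγ z
  obtain ⟨C, hC⟩ := (isCompact_Icc (a := (0 : ℝ≥0)) (b := T)).exists_bound_of_continuousOn
    ((hcont 1).sub (hcont 0)).continuousOn
  replace hC : ∀ t ≤ T, ‖picardIter b γ z 1 t - picardIter b γ z 0 t‖ ≤ C :=
    fun t ht => hC t ⟨zero_le, ht⟩
  have hC0 : 0 ≤ C := (norm_nonneg _).trans (hC T le_rfl)
  have hsum : Summable fun n : ℕ => C * ((K * T : ℝ) ^ n / n.factorial) :=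
    (Real.summable_pow_div_factorial _).mul_left C
  have hseries := tendstoUniformlyOn_tsum_nat (s := Iic T) hsum fun n t ht =>
    (norm_picardIter_succ_sub_le hb hγ hC n ht).trans (by gcongr; exact ht)
  rw [Metric.tendstoUniformlyOn_iff] at hseries ⊢
  refine fun ε hε => (hseries ε hε).mono fun n hn t ht => ?_
  have htel := Finset.sum_range_sub (fun k => picardIter b γ z k t) n
  rw [← sub_add_cancel (picardIter b γ z n t) (picardIter b γ z 0 t), ← htel, add_comm, flow,
    dist_add_left]
  exact hn t ht

theorem tendsto_picardIter [CompleteSpace E] (hb : LipschitzWith K b) (hγ : Continuous γ) (z : E)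
    (t : ℝ≥0) : Tendsto (fun n => picardIter b γ z n t) atTop (𝓝 (flow b γ z t)) :=
  (tendstoUniformlyOn_picardIter hb hγ z t).tendsto_at self_mem_Iic

theorem continuous_flow [CompleteSpace E] (hb : LipschitzWith K b) (hγ : Continuous γ) (z : E) :
    Continuous (flow b γ z) :=
  continuous_iff_continuousAt.2 fun t =>
    ((tendstoUniformlyOn_picardIter hb hγ z (t + 1)).continuousOn <| Frequently.of_forall fun n =>
      (continuous_picardIter hb.continuous hγ z n).continuousOn).continuousAt
        (Iic_mem_nhds (lt_add_one t))

theorem isDrivenPath_flow [CompleteSpace E] (hb : LipschitzWith K b) (hγ : Continuous γ) (z : E) :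
    IsDrivenPath b γ z (flow b γ z) := by
  refine ⟨continuous_flow hb hγ z, fun t => ?_⟩
  have hunif : TendstoUniformlyOn (fun n (s : ℝ) => b (picardIter b γ z n s.toNNReal))
      (fun s => b (flow b γ z s.toNNReal)) atTop (uIcc 0 t) :=
    (hb.uniformContinuous.comp_tendstoUniformlyOn
      ((tendstoUniformlyOn_picardIter hb hγ z t).comp Real.toNNReal)).mono fun s hs =>
        Real.toNNReal_le_iff_le_coe.2 (uIcc_of_le t.coe_nonneg ▸ hs).2
  have hlim := hunif.tendsto_intervalIntegral_of_continuousOn (μ := volume) <| .of_forall fun n =>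
    ((hb.continuous.comp (continuous_picardIter hb.continuous hγ z n)).comp
      continuous_real_toNNReal).continuousOn
  exact tendsto_nhds_unique ((tendsto_add_atTop_iff_nat 1).2 (tendsto_picardIter hb hγ z t))
    ((hlim.const_add z).add_const (γ t))

theorem flow_zero (b : E → E) (h0 : γ 0 = 0) (z : E) : flow b γ z 0 = z := by
  have h : ∀ n, picardIter b γ z n 0 = z := by rintro (_ | n) <;> simp [picardIter, h0]
  simp [flow, h]

theorem lipschitzWith_flow [CompleteSpace E] (hb : LipschitzWith K b) (hγ : Continuous γ)
    (t : ℝ≥0) : LipschitzWith (Real.exp (K * t)).toNNReal fun z => flow b γ z t :=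
  LipschitzWith.of_dist_le_mul fun z₁ z₂ => by
    rw [Real.coe_toNNReal _ (Real.exp_pos _).le, dist_eq_norm, dist_eq_norm]
    exact (isDrivenPath_flow hb hγ z₁).norm_sub_le hb (isDrivenPath_flow hb hγ z₂) t

variable {Ω : Type*} [MeasurableSpace Ω] [MeasurableSpace E] [BorelSpace E]
  [SecondCountableTopology E] {Γ : ℝ≥0 → Ω → E}

theorem measurable_picardIter (hb : Continuous b) (hΓc : ∀ ω, Continuous (Γ · ω))
    (hΓm : ∀ t, Measurable (Γ t)) (z : E) (n : ℕ) (t : ℝ≥0) :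
    Measurable fun ω => picardIter b (Γ · ω) z n t := by
  induction n generalizing t with
  | zero => exact (hΓm t).const_add z
  | succ n ih =>
    have hjoint : Measurable fun p : ℝ × Ω => b (picardIter b (Γ · p.2) z n p.1.toNNReal) :=
      hb.measurable.comp <| (measurable_uncurry_of_continuous_of_measurable
        (u := fun t ω => picardIter b (Γ · ω) z n t)
        (fun ω => continuous_picardIter hb (hΓc ω) z n) ih).comp
          (measurable_fst.real_toNNReal.prodMk measurable_snd)
    refine (Measurable.const_add ?_ z).add (hΓm t)
    simp_rw [intervalIntegral.integral_of_le (NNReal.coe_nonneg t)]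
    exact (hjoint.stronglyMeasurable.integral_prod_left').measurable

theorem measurable_flow [CompleteSpace E] (hb : LipschitzWith K b) (hΓc : ∀ ω, Continuous (Γ · ω))
    (hΓm : ∀ t, Measurable (Γ t)) (z : E) (t : ℝ≥0) : Measurable fun ω => flow b (Γ · ω) z t :=
  measurable_of_tendsto_metrizable (fun n => measurable_picardIter hb.continuous hΓc hΓm z n t)
    (tendsto_pi_nhds.2 fun ω => tendsto_picardIter hb (hΓc ω) z t)

theorem measurable_uncurry_flow [CompleteSpace E] (hb : LipschitzWith K b)
    (hΓc : ∀ ω, Continuous (Γ · ω)) (hΓm : ∀ t, Measurable (Γ t)) (t : ℝ≥0) :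
    Measurable (Function.uncurry fun z ω => flow b (Γ · ω) z t) :=
  measurable_uncurry_of_continuous_of_measurable
    (fun ω => (lipschitzWith_flow hb (hΓc ω) t).continuous) fun z => measurable_flow hb hΓc hΓm z t

end DrivenPath

section InnerContraction

variable {E F : Type*} [NormedAddCommGroup E] [NormedSpace ℝ E] [NormedAddCommGroup F]
  [InnerProductSpace ℝ F]

theorem norm_le_exp_mul_of_inner_deriv_right_le {u v : ℝ → F} {c t : ℝ}
    (hu : ContinuousOn u (Icc 0 t))
    (hv : ∀ s ∈ Ico 0 t, HasDerivWithinAt u (v s) (Ici s) s)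
    (huv : ∀ s ∈ Ico 0 t, ⟪u s, v s⟫_ℝ ≤ c * ‖u s‖ ^ 2) (ht : 0 ≤ t) :
    ‖u t‖ ≤ Real.exp (c * t) * ‖u 0‖ := by
  have hsq := le_gronwallBound_of_liminf_deriv_right_le (f := fun s => ‖u s‖ ^ 2)
    (δ := ‖u 0‖ ^ 2) (K := 2 * c) (ε := 0) (hu.norm.pow 2)
    (fun s hs r hr => (hv s hs).norm_sq.liminf_right_slope_le hr) le_rfl
    (fun s hs => by linarith [huv s hs]) t (right_mem_Icc.2 ht)
  refine le_of_sq_le_sq (hsq.trans_eq ?_) (by positivity)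
  rw [gronwallBound_ε0, mul_pow, ← Real.exp_nat_mul, mul_comm]
  congr 2
  push_cast
  ring

theorem inner_deriv_right_le_of_norm_le_exp_mul {u : ℝ → F} {u' : F} {c : ℝ}
    (hu : HasDerivWithinAt u u' (Ici 0) 0)
    (hle : ∀ t, 0 ≤ t → ‖u t‖ ≤ Real.exp (c * t) * ‖u 0‖) : ⟪u 0, u'⟫_ℝ ≤ c * ‖u 0‖ ^ 2 := by
  have hexp : HasDerivAt (fun t => (Real.exp (c * t) * ‖u 0‖) ^ 2) (2 * (c * ‖u 0‖ ^ 2)) 0 := by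
    convert! ((((hasDerivAt_id (0 : ℝ)).const_mul c).exp).mul_const ‖u 0‖).pow 2 using 1
    simp
    ring
  have hgap := (hasDerivWithinAt_iff_tendsto_slope' self_notMem_Ioi).1
    ((hexp.hasDerivWithinAt.sub hu.norm_sq).mono Ioi_subset_Ici_self)
  have hnonneg := ge_of_tendsto hgap <| eventually_mem_nhdsWithin.mono fun t ht => by
    rw [slope_def_field]
    refine div_nonneg ?_ (by simpa using ht.le)
    simpa using pow_le_pow_left₀ (norm_nonneg _) (hle t ht.le) 2
  linarith

/-- `b` is one-sided Lipschitz with constant `c` for the semi-inner product `⟪A x, A y⟫`. For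
`c < 0` this is strict dissipativity. -/
def OneSidedLipschitz (A : E →L[ℝ] F) (c : ℝ) (b : E → E) : Prop :=
  ∀ x y, ⟪A (x - y), A (b x - b y)⟫_ℝ ≤ c * ‖A (x - y)‖ ^ 2

theorem OneSidedLipschitz.norm_sub_le [CompleteSpace E] {A : E →L[ℝ] F} {c : ℝ} {b : E → E}
    (h : OneSidedLipschitz A c b) (hb : Continuous b) {γ x₁ x₂ : ℝ≥0 → E} {z₁ z₂ : E}
    (h₁ : IsDrivenPath b γ z₁ x₁) (h₂ : IsDrivenPath b γ z₂ x₂) (t : ℝ≥0) :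
    ‖A (x₁ t - x₂ t)‖ ≤ Real.exp (c * t) * ‖A (z₁ - z₂)‖ := by
  have hle := norm_le_exp_mul_of_inner_deriv_right_le
    (A.continuous.comp (h₁.continuous_sub h₂)).continuousOn
    (fun s hs => A.hasFDerivAt.comp_hasDerivWithinAt s (h₁.hasDerivWithinAt_sub hb h₂ hs.1))
    (fun s _ => h _ _) t.2
  simpa [-map_sub, h₁.sub_zero hb h₂] using hle

theorem hasDerivAt_inner_map_line {b : E → E} (hb : Differentiable ℝ b) (A : E →L[ℝ] F)
    (p : F) (z x : E) (θ : ℝ) :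
    HasDerivAt (fun θ : ℝ => ⟪p, A (b (z + θ • x))⟫_ℝ) ⟪p, A (fderiv ℝ b (z + θ • x) x)⟫_ℝ θ := by
  have hline : HasDerivAt (fun θ : ℝ => z + θ • x) x θ := by
    simpa using ((hasDerivAt_id θ).smul_const x).const_add z
  exact (innerSL ℝ p).hasFDerivAt.comp_hasDerivAt θ
    (A.hasFDerivAt.comp_hasDerivAt θ ((hb _).hasFDerivAt.comp_hasDerivAt θ hline))

theorem oneSidedLipschitz_iff_fderiv {b : E → E} (hb : Differentiable ℝ b) {A : E →L[ℝ] F}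
    {c : ℝ} :
    OneSidedLipschitz A c b ↔ ∀ z x, ⟪A x, A (fderiv ℝ b z x)⟫_ℝ ≤ c * ‖A x‖ ^ 2 := by
  refine ⟨fun h z x => ?_, fun h z y => ?_⟩
  · have hderiv := hasDerivAt_inner_map_line hb A (A x) z x 0
    rw [zero_smul, add_zero] at hderiv
    refine le_of_tendsto ((hasDerivWithinAt_iff_tendsto_slope' self_notMem_Ioi).1
      (hderiv.hasDerivWithinAt (s := Ioi 0))) <| eventually_mem_nhdsWithin.mono fun θ hθ => ?_
    have hθ' : 0 < θ := hθ
    have hstep := h (z + θ • x) z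
    simp only [add_sub_cancel_left, map_smul, inner_smul_left, norm_smul, Real.norm_eq_abs,
      mul_pow, sq_abs, RCLike.conj_to_real] at hstep
    rw [slope_def_field, sub_zero, zero_smul, add_zero, ← inner_sub_right, ← map_sub,
      div_le_iff₀ hθ']
    nlinarith
  · have hmvt := image_sub_le_mul_sub_of_deriv_le
      (fun θ => (hasDerivAt_inner_map_line hb A (A (z - y)) y (z - y) θ).differentiableAt)
      (fun θ => (hasDerivAt_inner_map_line hb A _ y _ θ).deriv.trans_le (h _ _))
      (zero_le_one (α := ℝ))
    simpa [← inner_sub_right, ← map_sub] using hmvt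

end InnerContraction

section WeightedNorm

variable {d : ℕ} {M : Matrix (Fin d) (Fin d) ℝ} {x y : EuclideanSpace ℝ (Fin d)}

open scoped MatrixOrder in
/-- The map `√M`: it turns `‖·‖_M` into the Euclidean norm (for positive semidefinite `M`). -/
noncomputable def sqrtMap (M : Matrix (Fin d) (Fin d) ℝ) :
    EuclideanSpace ℝ (Fin d) →L[ℝ] EuclideanSpace ℝ (Fin d) :=
  Matrix.toEuclideanCLM (𝕜 := ℝ) (CFC.sqrt M)

open scoped MatrixOrder in
theorem inner_sqrtMap (hM : M.PosSemidef) (x y : EuclideanSpace ℝ (Fin d)) :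
    ⟪sqrtMap M x, sqrtMap M y⟫_ℝ = x.ofLp ⬝ᵥ M *ᵥ y.ofLp := by
  have hsymm : (CFC.sqrt M)ᵀ = CFC.sqrt M := by
    simpa using (CFC.sqrt_nonneg M).posSemidef.isHermitian.eq
  have hsq : CFC.sqrt M * CFC.sqrt M = M := CFC.sqrt_mul_sqrt_self M hM.nonneg
  rw [EuclideanSpace.inner_eq_star_dotProduct, sqrtMap]
  simp only [Matrix.ofLp_toEuclideanCLM, star_trivial]
  rw [dotProduct_comm, ← Matrix.vecMul_transpose, hsymm, ← Matrix.dotProduct_mulVec,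
    Matrix.mulVec_mulVec, hsq]

theorem normM_eq_norm_sqrtMap (hM : M.PosSemidef) (x : EuclideanSpace ℝ (Fin d)) :
    normM M x = ‖sqrtMap M x‖ := by
  rw [normM, ← inner_sqrtMap hM, real_inner_self_eq_norm_sq, Real.sqrt_sq (norm_nonneg _)]

theorem normM_nonneg (M : Matrix (Fin d) (Fin d) ℝ) (x : EuclideanSpace ℝ (Fin d)) :
    0 ≤ normM M x :=
  Real.sqrt_nonneg _

theorem continuous_normM (M : Matrix (Fin d) (Fin d) ℝ) : Continuous (normM M) := by
  unfold normM
  fun_prop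

theorem continuous_normM_sub (M : Matrix (Fin d) (Fin d) ℝ) :
    Continuous fun p : EuclideanSpace ℝ (Fin d) × EuclideanSpace ℝ (Fin d) => normM M (p.1 - p.2) :=
  (continuous_normM M).comp (continuous_fst.sub continuous_snd)

theorem normM_smul (M : Matrix (Fin d) (Fin d) ℝ) (a : ℝ) (x : EuclideanSpace ℝ (Fin d)) :
    normM M (a • x) = |a| * normM M x := by
  rw [normM, normM, ← Real.sqrt_sq_eq_abs, ← Real.sqrt_mul (sq_nonneg a), WithLp.ofLp_smul,
    Matrix.mulVec_smul, smul_dotProduct, dotProduct_smul, smul_eq_mul, smul_eq_mul, sq, mul_assoc]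

theorem normM_neg (M : Matrix (Fin d) (Fin d) ℝ) (x : EuclideanSpace ℝ (Fin d)) :
    normM M (-x) = normM M x := by
  simpa using normM_smul M (-1) x

theorem normM_sub_comm (M : Matrix (Fin d) (Fin d) ℝ) (x y : EuclideanSpace ℝ (Fin d)) :
    normM M (x - y) = normM M (y - x) := by
  rw [← normM_neg, neg_sub]

theorem normM_pos_iff (hM : M.PosDef) : 0 < normM M x ↔ x ≠ 0 := by
  refine ⟨?_, fun hx => Real.sqrt_pos.2 ?_⟩
  · rintro h rfl
    simp [normM] at h
  · simpa using hM.dotProduct_mulVec_pos (x := x.ofLp) (by simpa using hx)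

theorem normM_sub_pos_iff (hM : M.PosDef) : 0 < normM M (x - y) ↔ x ≠ y := by
  rw [normM_pos_iff hM, sub_ne_zero]

theorem exists_norm_le_mul_normM (hM : M.PosDef) : ∃ c, 0 < c ∧ ∀ x, ‖x‖ ≤ c * normM M x := by
  have hinj : Function.Injective (sqrtMap M) := by
    refine (injective_iff_map_eq_zero _).2 fun x hx => ?_
    by_contra hne
    have hpos := (normM_pos_iff hM).2 hne
    rw [normM_eq_norm_sqrtMap hM.posSemidef, hx, norm_zero] at hpos
    exact hpos.false
  obtain ⟨c, hc, h⟩ := (sqrtMap M).toLinearMap.exists_antilipschitzWith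
    (LinearMap.ker_eq_bot.2 hinj)
  exact ⟨c, hc, fun x => by
    simpa [normM_eq_norm_sqrtMap hM.posSemidef] using h.le_mul_dist x 0⟩

theorem jacobian_mulVec (b : EuclideanSpace ℝ (Fin d) → EuclideanSpace ℝ (Fin d))
    (z x : EuclideanSpace ℝ (Fin d)) : jacobian b z *ᵥ x.ofLp = (fderiv ℝ b z x).ofLp := by
  have hx : x = ∑ j, x j • EuclideanSpace.single j (1 : ℝ) := by
    ext i
    simp [Finset.sum_apply, Pi.single_apply]
  ext i
  conv_rhs => rw [hx, map_sum]
  simp [jacobian, Matrix.mulVec, dotProduct, mul_comm]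

theorem contR_iff_oneSidedLipschitz (hM : M.PosSemidef)
    {b : EuclideanSpace ℝ (Fin d) → EuclideanSpace ℝ (Fin d)} (hb : Differentiable ℝ b) {ρ : ℝ} :
    ContR b M ρ ↔ OneSidedLipschitz (sqrtMap M) (-ρ) b := by
  rw [oneSidedLipschitz_iff_fderiv hb]
  refine forall_congr' fun z => (WithLp.equiv 2 (Fin d → ℝ)).symm.forall_congr fun x => ?_
  simp only [WithLp.equiv_symm_apply, inner_sqrtMap hM, ← real_inner_self_eq_norm_sq,
    ← jacobian_mulVec, Matrix.mulVec_mulVec, Matrix.smul_mulVec, dotProduct_smul, smul_eq_mul]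

end WeightedNorm

section Slope

theorem norm_sub_le_of_forall_eventually_norm_sub_le {F : Type*} [NormedAddCommGroup F]
    {g : ℝ → F} {C : ℝ}
    (h : ∀ θ C', C < C' → ∀ᶠ s in 𝓝 θ, ‖g s - g θ‖ ≤ C' * |s - θ|) {a b : ℝ} (hab : a ≤ b) :
    ‖g b - g a‖ ≤ C * (b - a) := by
  have hcont : Continuous g := continuous_iff_continuousAt.2 fun θ => by
    refine tendsto_iff_norm_sub_tendsto_zero.2 <|
      squeeze_zero' (.of_forall fun _ => norm_nonneg _) (h θ (C + 1) (lt_add_one C)) ?_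
    have hlim : Continuous fun s => (C + 1) * |s - θ| := by fun_prop
    simpa using hlim.tendsto θ
  refine image_le_of_liminf_slope_right_le_deriv_boundary (f := fun θ => ‖g θ - g a‖)
    (B := fun θ => C * (θ - a)) (B' := fun _ => C) (by fun_prop) (by simp) (by fun_prop)
    (fun θ _ => by
      simpa using (((hasDerivAt_id θ).sub_const a).const_mul C).hasDerivWithinAt)
    (fun θ _ r hr => ?_) (right_mem_Icc.2 hab)
  obtain ⟨C', hCC', hC'r⟩ := exists_between hr
  have hright : ∀ᶠ s in 𝓝[>] θ, θ < s := self_mem_nhdsWithin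
  refine (((h θ C' hCC').filter_mono nhdsWithin_le_nhds).and hright).frequently.mono
    fun s ⟨hs, hθs⟩ => ?_
  have hpos : 0 < s - θ := sub_pos.2 hθs
  rw [slope_def_field, div_lt_iff₀ hpos]
  calc ‖g s - g a‖ - ‖g θ - g a‖ ≤ ‖g s - g θ‖ := by
        simpa using norm_sub_norm_le (g s - g a) (g θ - g a)
    _ ≤ C' * (s - θ) := by rwa [abs_of_pos hpos] at hs
    _ < r * (s - θ) := by gcongr

variable {d : ℕ} {M : Matrix (Fin d) (Fin d) ℝ} {f : EuclideanSpace ℝ (Fin d) → ℝ}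
  {y z : EuclideanSpace ℝ (Fin d)} {r : ℝ}

theorem slopeM_le_iff (h : 0 < normM M (z - y)) {L : ℝ≥0∞} :
    slopeM M f z y ≤ L ↔ ENNReal.ofReal |f z - f y| ≤ L * ENNReal.ofReal (normM M (z - y)) := by
  rw [slopeM, normM_sub_comm, ENNReal.ofReal_div_of_pos h,
    ENNReal.div_le_iff (by simpa using h) (by simp)]

theorem gradNormSup_le_iff (hM : M.PosDef) {L : ℝ≥0∞} :
    gradNormSup M f ≤ L ↔
      ∀ z y, ENNReal.ofReal |f z - f y| ≤ L * ENNReal.ofReal (normM M (z - y)) := by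
  simp only [gradNormSup, iSup_le_iff]
  refine forall₂_congr fun z y => ?_
  rcases eq_or_ne z y with rfl | hne
  · simp
  · simp [hne, ← slopeM_le_iff ((normM_sub_pos_iff hM).2 hne)]

theorem gradNormSup_le_ofReal_iff (hM : M.PosDef) {L : ℝ} (hL : 0 ≤ L) :
    gradNormSup M f ≤ ENNReal.ofReal L ↔ ∀ z y, |f z - f y| ≤ L * normM M (z - y) := by
  rw [gradNormSup_le_iff hM]
  refine forall₂_congr fun z y => ?_
  rw [← ENNReal.ofReal_mul hL, ENNReal.ofReal_le_ofReal_iff (mul_nonneg hL (normM_nonneg _ _))]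

theorem gradNormSup_ne_top (hM : M.PosDef) {K : ℝ≥0} (hf : LipschitzWith K f) :
    gradNormSup M f ≠ ∞ := by
  obtain ⟨c, hc, hnorm⟩ := exists_norm_le_mul_normM hM
  refine ne_top_of_le_ne_top (ENNReal.ofReal_ne_top (r := K * c))
    ((gradNormSup_le_ofReal_iff hM (by positivity)).2 fun z y => ?_)
  calc |f z - f y| ≤ K * ‖z - y‖ := by simpa [Real.dist_eq, dist_eq_norm] using hf.dist_le_mul z y
    _ ≤ K * (c * normM M (z - y)) := by gcongr; exact hnorm _
    _ = K * c * normM M (z - y) := by ring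

/-- The supremum of the slopes of `f` at `z` at scale `r`. It decreases to `gradNorm M f z` as
`r ↓ 0`. -/
noncomputable def localSlope (M : Matrix (Fin d) (Fin d) ℝ) (f : EuclideanSpace ℝ (Fin d) → ℝ)
    (r : ℝ) (z : EuclideanSpace ℝ (Fin d)) : ℝ≥0∞ :=
  ⨆ (y : EuclideanSpace ℝ (Fin d)) (_ : 0 < normM M (z - y) ∧ normM M (z - y) ≤ r), slopeM M f z y

theorem localSlope_mono (M : Matrix (Fin d) (Fin d) ℝ) (f : EuclideanSpace ℝ (Fin d) → ℝ)
    (z : EuclideanSpace ℝ (Fin d)) : Monotone fun r => localSlope M f r z :=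
  fun _ _ h => iSup_mono fun _ => iSup_mono' fun hy => ⟨⟨hy.1, hy.2.trans h⟩, le_rfl⟩

theorem gradNorm_le_localSlope (M : Matrix (Fin d) (Fin d) ℝ) (f : EuclideanSpace ℝ (Fin d) → ℝ)
    (hr : 0 < r) (z : EuclideanSpace ℝ (Fin d)) : gradNorm M f z ≤ localSlope M f r z :=
  iInf₂_le r hr

theorem localSlope_le_gradNormSup (M : Matrix (Fin d) (Fin d) ℝ)
    (f : EuclideanSpace ℝ (Fin d) → ℝ) (r : ℝ) (z : EuclideanSpace ℝ (Fin d)) :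
    localSlope M f r z ≤ gradNormSup M f :=
  iSup₂_le fun y hy => le_iSup_of_le z <| le_iSup₂_of_le y
    (by rintro rfl; simp [normM] at hy) le_rfl

theorem gradNorm_le_gradNormSup (M : Matrix (Fin d) (Fin d) ℝ)
    (f : EuclideanSpace ℝ (Fin d) → ℝ) (z : EuclideanSpace ℝ (Fin d)) :
    gradNorm M f z ≤ gradNormSup M f :=
  (gradNorm_le_localSlope M f one_pos z).trans (localSlope_le_gradNormSup M f 1 z)

theorem ofReal_abs_sub_le_localSlope_mul (hM : M.PosDef) (h : normM M (z - y) ≤ r) :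
    ENNReal.ofReal |f z - f y| ≤ localSlope M f r z * ENNReal.ofReal (normM M (z - y)) := by
  rcases eq_or_ne z y with rfl | hne
  · simp
  · have hpos := (normM_sub_pos_iff hM).2 hne
    exact (slopeM_le_iff hpos).1 (le_iSup₂_of_le y ⟨hpos, h⟩ le_rfl)

theorem gradNorm_eq_iInf_nat (M : Matrix (Fin d) (Fin d) ℝ) (f : EuclideanSpace ℝ (Fin d) → ℝ)
    (z : EuclideanSpace ℝ (Fin d)) : gradNorm M f z = ⨅ n : ℕ, localSlope M f (1 / (n + 1)) z := by
  refine le_antisymm (le_iInf fun n => gradNorm_le_localSlope M f Nat.one_div_pos_of_nat z)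
    (le_iInf₂ fun r hr => ?_)
  obtain ⟨n, hn⟩ := exists_nat_one_div_lt hr
  exact (iInf_le _ n).trans (localSlope_mono M f z hn.le)

theorem localSlope_eq_iSup_add (M : Matrix (Fin d) (Fin d) ℝ) (f : EuclideanSpace ℝ (Fin d) → ℝ)
    (r : ℝ) (z : EuclideanSpace ℝ (Fin d)) :
    localSlope M f r z = ⨆ (h : EuclideanSpace ℝ (Fin d)) (_ : 0 < normM M h ∧ normM M h ≤ r),
      ENNReal.ofReal (|f z - f (z + h)| / normM M h) := by
  refine ((Equiv.addLeft z).iSup_congr fun h => ?_).symm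
  simp [slopeM, normM_neg]

theorem measurable_localSlope (M : Matrix (Fin d) (Fin d) ℝ) (hf : Continuous f) (r : ℝ) :
    Measurable (localSlope M f r) := by
  simp_rw [funext (localSlope_eq_iSup_add M f r)]
  refine (lowerSemicontinuous_iSup fun h => lowerSemicontinuous_iSup fun _ =>
    (ENNReal.continuous_ofReal.comp ?_).lowerSemicontinuous).measurable
  fun_prop

theorem eventually_abs_sub_le_of_gradNorm_lt (hM : M.PosDef) {C : ℝ}
    (h : gradNorm M f z < ENNReal.ofReal C) : ∀ᶠ y in 𝓝 z, |f z - f y| ≤ C * normM M (z - y) := by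
  have hC : 0 < C := ENNReal.ofReal_pos.1 (bot_le.trans_lt h)
  obtain ⟨r, hr, hlt⟩ : ∃ r, 0 < r ∧ localSlope M f r z < ENNReal.ofReal C := by
    simpa only [gradNorm, localSlope, iInf_lt_iff, exists_prop] using h
  have hnear : ∀ᶠ y in 𝓝 z, normM M (z - y) < r :=
    ((continuous_normM M).comp (continuous_const.sub continuous_id)).continuousAt.eventually_lt
      continuousAt_const (by simpa [normM] using hr)
  filter_upwards [hnear] with y hy
  rw [← ENNReal.ofReal_le_ofReal_iff (mul_nonneg hC.le (normM_nonneg _ _)),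
    ENNReal.ofReal_mul hC.le]
  exact (ofReal_abs_sub_le_localSlope_mul hM hy.le).trans (by gcongr)

theorem gradNormSup_le_of_gradNorm_le (hM : M.PosDef) {L : ℝ≥0∞} (h : ∀ z, gradNorm M f z ≤ L) :
    gradNormSup M f ≤ L := by
  rcases eq_or_ne L ∞ with rfl | hL
  · exact le_top
  rw [← ENNReal.ofReal_toReal hL, gradNormSup_le_ofReal_iff hM ENNReal.toReal_nonneg]
  intro z y
  rcases eq_or_ne z y with rfl | hne
  · simp [normM]
  have hpos := (normM_sub_pos_iff hM).2 hne
  have hline : Continuous fun θ : ℝ => y + θ • (z - y) := by fun_prop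
  have hstep : ∀ θ C' : ℝ, L.toReal * normM M (z - y) < C' →
      ∀ᶠ s in 𝓝 θ, ‖f (y + s • (z - y)) - f (y + θ • (z - y))‖ ≤ C' * |s - θ| := by
    intro θ C' hC'
    have hlt : gradNorm M f (y + θ • (z - y)) < ENNReal.ofReal (C' / normM M (z - y)) :=
      (h _).trans_lt <| (ENNReal.lt_ofReal_iff_toReal_lt hL).2 <| (lt_div_iff₀ hpos).2 hC'
    filter_upwards [hline.continuousAt.eventually (eventually_abs_sub_le_of_gradNorm_lt hM hlt)]
      with s hs
    rwa [add_sub_add_left_eq_sub, ← sub_smul, normM_smul, abs_sub_comm, abs_sub_comm θ,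
      mul_left_comm, div_mul_cancel₀ _ hpos.ne', mul_comm] at hs
  simpa using norm_sub_le_of_forall_eventually_norm_sub_le hstep zero_le_one

end Slope

section Wasserstein

variable {d : ℕ} {M : Matrix (Fin d) (Fin d) ℝ} {ν μ : Measure (EuclideanSpace ℝ (Fin d))}
  {f : EuclideanSpace ℝ (Fin d) → ℝ}

theorem nonempty_couplings (ν μ : Measure (EuclideanSpace ℝ (Fin d))) [IsProbabilityMeasure ν]
    [IsProbabilityMeasure μ] : (couplings ν μ).Nonempty :=
  ⟨ν.prod μ, by simp, by simp⟩

theorem isProbabilityMeasure_of_mem_couplings [hν : IsProbabilityMeasure ν]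
    {π : Measure (EuclideanSpace ℝ (Fin d) × EuclideanSpace ℝ (Fin d))} (hπ : π ∈ couplings ν μ) :
    IsProbabilityMeasure π := by
  rw [← hπ.1] at hν
  exact Measure.isProbabilityMeasure_of_map Prod.fst

theorem le_mul_wasserstein [IsProbabilityMeasure ν] [IsProbabilityMeasure μ] {r a L : ℝ≥0∞}
    (hL : L ≠ ∞)
    (h : ∀ π ∈ couplings ν μ, a ≤ L * eLpNorm (fun p => normM M (p.1 - p.2)) r π) :
    a ≤ L * wasserstein M r ν μ := by
  have := (nonempty_couplings ν μ).to_subtype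
  rw [wasserstein, iInf_subtype', ENNReal.mul_iInf (by simp [hL])]
  exact le_iInf fun π => h π.1 π.2

theorem wasserstein_mono [IsProbabilityMeasure ν] {r s : ℝ≥0∞} (hrs : r ≤ s) :
    wasserstein M r ν μ ≤ wasserstein M s ν μ := by
  refine iInf₂_mono fun π hπ => ?_
  have := isProbabilityMeasure_of_mem_couplings hπ
  exact eLpNorm_le_eLpNorm_of_exponent_le hrs (continuous_normM_sub M).aestronglyMeasurable

theorem wasserstein_dirac_le (M : Matrix (Fin d) (Fin d) ℝ) {r : ℝ≥0∞} (hr : r ≠ 0)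
    (z y : EuclideanSpace ℝ (Fin d)) :
    wasserstein M r (.dirac z) (.dirac y) ≤ ENNReal.ofReal (normM M (z - y)) := by
  have hmem : Measure.dirac (z, y) ∈ couplings (.dirac z) (.dirac y) :=
    ⟨Measure.map_dirac' measurable_fst _, Measure.map_dirac' measurable_snd _⟩
  calc wasserstein M r (.dirac z) (.dirac y)
      ≤ eLpNorm (fun p => normM M (p.1 - p.2)) r (.dirac (z, y)) := iInf₂_le _ hmem
    _ = ENNReal.ofReal (normM M (z - y)) := by
      rw [eLpNorm_dirac _ _ hr, Real.enorm_of_nonneg (normM_nonneg _ _)]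

theorem IsBoundedLipschitz.continuous (hf : IsBoundedLipschitz f) : Continuous f :=
  hf.2.choose_spec.continuous

theorem IsBoundedLipschitz.integrable_comp (hf : IsBoundedLipschitz f) {α : Type*}
    [MeasurableSpace α] {P : Measure α} [IsFiniteMeasure P] {g : α → EuclideanSpace ℝ (Fin d)}
    (hg : AEMeasurable g P) : Integrable (fun a => f (g a)) P :=
  .of_bound (hf.continuous.measurable.comp_aemeasurable hg).aestronglyMeasurable hf.1.choose
    (ae_of_all _ fun _ => hf.1.choose_spec _)

theorem ofReal_abs_integral_sub_le_gradNormSup_mul_wasserstein (hM : M.PosDef)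
    (hf : IsBoundedLipschitz f) (ν μ : Measure (EuclideanSpace ℝ (Fin d)))
    [IsProbabilityMeasure ν] [IsProbabilityMeasure μ] :
    ENNReal.ofReal |∫ x, f x ∂ν - ∫ x, f x ∂μ| ≤ gradNormSup M f * wasserstein M 1 ν μ := by
  have hL : gradNormSup M f ≠ ∞ := gradNormSup_ne_top hM hf.2.choose_spec
  refine le_mul_wasserstein hL fun π hπ => ?_
  have := isProbabilityMeasure_of_mem_couplings hπ
  have hdiff : ∫ x, f x ∂ν - ∫ x, f x ∂μ = ∫ p, (f p.1 - f p.2) ∂π := by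
    rw [integral_sub (hf.integrable_comp measurable_fst.aemeasurable)
      (hf.integrable_comp measurable_snd.aemeasurable), ← hπ.1, ← hπ.2,
      integral_map measurable_fst.aemeasurable hf.continuous.aestronglyMeasurable,
      integral_map measurable_snd.aemeasurable hf.continuous.aestronglyMeasurable]
  rw [hdiff, ← Real.enorm_eq_ofReal_abs, eLpNorm_one_eq_lintegral_enorm,
    ← lintegral_const_mul' _ _ hL]
  refine (enorm_integral_le_lintegral_enorm _).trans (lintegral_mono fun p => ?_)
  rw [Real.enorm_eq_ofReal_abs, Real.enorm_of_nonneg (normM_nonneg _ _)]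
  exact (gradNormSup_le_iff hM).1 le_rfl _ _

theorem gradNormSup_integral_le_of_wasserstein_bind_le (hM : M.PosDef)
    {κ : EuclideanSpace ℝ (Fin d) → Measure (EuclideanSpace ℝ (Fin d))} (hκ : Measurable κ)
    [∀ z, IsProbabilityMeasure (κ z)] {r c : ℝ≥0∞} (hr : 1 ≤ r)
    (h : ∀ (ν μ : Measure (EuclideanSpace ℝ (Fin d))) [IsProbabilityMeasure ν]
      [IsProbabilityMeasure μ], wasserstein M r (ν.bind κ) (μ.bind κ) ≤ c * wasserstein M r ν μ)
    (hf : IsBoundedLipschitz f) :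
    gradNormSup M (fun z => ∫ x, f x ∂κ z) ≤ c * gradNormSup M f := by
  refine (gradNormSup_le_iff hM).2 fun z y => ?_
  have hdirac : wasserstein M r (κ z) (κ y) ≤ c * wasserstein M r (.dirac z) (.dirac y) := by
    simpa only [Measure.dirac_bind hκ] using h (.dirac z) (.dirac y)
  calc ENNReal.ofReal |∫ x, f x ∂κ z - ∫ x, f x ∂κ y|
      ≤ gradNormSup M f * wasserstein M 1 (κ z) (κ y) :=
        ofReal_abs_integral_sub_le_gradNormSup_mul_wasserstein hM hf _ _
    _ ≤ gradNormSup M f * (c * wasserstein M r (.dirac z) (.dirac y)) := by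
        gcongr
        exact (wasserstein_mono hr).trans hdirac
    _ ≤ gradNormSup M f * (c * ENNReal.ofReal (normM M (z - y))) := by
        gcongr
        exact wasserstein_dirac_le M (one_pos.trans_le hr).ne' z y
    _ = c * gradNormSup M f * ENNReal.ofReal (normM M (z - y)) := by ring

end Wasserstein

section RandomMap

variable {Ω : Type*} [MeasurableSpace Ω] {P : Measure Ω} {d : ℕ} {M : Matrix (Fin d) (Fin d) ℝ}
  {φ : EuclideanSpace ℝ (Fin d) → Ω → EuclideanSpace ℝ (Fin d)}
  {f : EuclideanSpace ℝ (Fin d) → ℝ} {c : ℝ}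

theorem measurable_map_of_measurable_uncurry [SFinite P] {E F : Type*} [MeasurableSpace E]
    [MeasurableSpace F] {φ : E → Ω → F} (hφ : Measurable (Function.uncurry φ)) :
    Measurable fun z => P.map (φ z) := by
  have hmap : (fun z => P.map (φ z)) =
      fun z => (P.map (Prod.mk z)).map (Function.uncurry φ) := by
    ext1 z
    rw [Measure.map_map hφ measurable_prodMk_left]
    rfl
  rw [hmap]
  exact (Measure.measurable_map _ hφ).comp Measurable.map_prodMk_left

theorem map_prod_eq_bind_map [SFinite P] {α E F : Type*} [MeasurableSpace α] [MeasurableSpace E]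
    [MeasurableSpace F] {φ : E → Ω → F} (hφ : Measurable (Function.uncurry φ)) (π : Measure α)
    {g : α → E} (hg : Measurable g) :
    (π.prod P).map (fun q => φ (g q.1) q.2) = (π.map g).bind fun z => P.map (φ z) := by
  have hκ := measurable_map_of_measurable_uncurry (P := P) hφ
  have hm : Measurable fun q : α × Ω => φ (g q.1) q.2 :=
    hφ.comp ((hg.comp measurable_fst).prodMk measurable_snd)
  ext s hs
  rw [Measure.map_apply hm hs, Measure.prod_apply (hm hs), Measure.bind_apply hs hκ.aemeasurable,
    lintegral_map (f := fun z => P.map (φ z) s) ((Measure.measurable_coe hs).comp hκ) hg]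
  refine lintegral_congr fun a => ?_
  rw [Measure.map_apply hφ.of_uncurry_left hs]
  rfl

theorem measurable_pair_of_measurable_uncurry {E F : Type*} [MeasurableSpace E]
    [MeasurableSpace F] {φ : E → Ω → F} (hφ : Measurable (Function.uncurry φ)) :
    Measurable fun q : (E × E) × Ω => (φ q.1.1 q.2, φ q.1.2 q.2) :=
  (hφ.comp (measurable_fst.fst.prodMk measurable_snd)).prodMk
    (hφ.comp (measurable_fst.snd.prodMk measurable_snd))

theorem map_prod_mem_couplings [SFinite P] (hφ : Measurable (Function.uncurry φ))
    {ν μ : Measure (EuclideanSpace ℝ (Fin d))}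
    {π : Measure (EuclideanSpace ℝ (Fin d) × EuclideanSpace ℝ (Fin d))}
    (hπ : π ∈ couplings ν μ) :
    (π.prod P).map (fun q => (φ q.1.1 q.2, φ q.1.2 q.2)) ∈
      couplings (ν.bind fun z => P.map (φ z)) (μ.bind fun z => P.map (φ z)) := by
  have hm := measurable_pair_of_measurable_uncurry hφ
  constructor
  · rw [Measure.map_map measurable_fst hm, ← hπ.1, ← map_prod_eq_bind_map hφ π measurable_fst]
    rfl
  · rw [Measure.map_map measurable_snd hm, ← hπ.2, ← map_prod_eq_bind_map hφ π measurable_snd]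
    rfl

theorem wasserstein_bind_map_le [IsProbabilityMeasure P] (hφ : Measurable (Function.uncurry φ))
    (h : ∀ z y, ∀ᵐ ω ∂P, normM M (φ z ω - φ y ω) ≤ c * normM M (z - y)) (r : ℝ≥0∞)
    (ν μ : Measure (EuclideanSpace ℝ (Fin d))) [IsProbabilityMeasure ν] [IsProbabilityMeasure μ] :
    wasserstein M r (ν.bind fun z => P.map (φ z)) (μ.bind fun z => P.map (φ z)) ≤
      ENNReal.ofReal c * wasserstein M r ν μ := by
  refine le_mul_wasserstein ENNReal.ofReal_ne_top fun π hπ => ?_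
  have := isProbabilityMeasure_of_mem_couplings hπ
  have hN := continuous_normM_sub M
  have hm := measurable_pair_of_measurable_uncurry hφ
  have hcontr : ∀ᵐ q ∂π.prod P, ‖normM M (φ q.1.1 q.2 - φ q.1.2 q.2)‖ ≤
      c * ‖normM M (q.1.1 - q.1.2)‖ := by
    simp only [Real.norm_of_nonneg (normM_nonneg _ _)]
    rw [Measure.ae_prod_iff_ae_ae]
    · exact ae_of_all _ fun p => h p.1 p.2
    · exact measurableSet_le (hN.measurable.comp hm)
        ((hN.measurable.comp measurable_fst).const_mul c)
  calc wasserstein M r (ν.bind fun z => P.map (φ z)) (μ.bind fun z => P.map (φ z))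
      ≤ eLpNorm (fun p => normM M (p.1 - p.2)) r
          ((π.prod P).map fun q => (φ q.1.1 q.2, φ q.1.2 q.2)) :=
        iInf₂_le _ (map_prod_mem_couplings hφ hπ)
    _ = eLpNorm (fun q => normM M (φ q.1.1 q.2 - φ q.1.2 q.2)) r (π.prod P) :=
        eLpNorm_map_measure hN.aestronglyMeasurable hm.aemeasurable
    _ ≤ ENNReal.ofReal c * eLpNorm (fun q => normM M (q.1.1 - q.1.2)) r (π.prod P) :=
        eLpNorm_le_mul_eLpNorm_of_ae_le_mul hcontr r
    _ = ENNReal.ofReal c * eLpNorm (fun p => normM M (p.1 - p.2)) r π := by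
        rw [← Measure.fst_prod (μ := π) (ν := P), Measure.fst,
          eLpNorm_map_measure hN.aestronglyMeasurable measurable_fst.aemeasurable]
        simp [Measure.map_fst_prod]
        rfl

theorem localSlope_integral_le (hM : M.PosDef) (hc : 0 < c)
    (h : ∀ z y, ∀ᵐ ω ∂P, normM M (φ z ω - φ y ω) ≤ c * normM M (z - y))
    (hf : ∀ z, Integrable (fun ω => f (φ z ω)) P) (r : ℝ) (z : EuclideanSpace ℝ (Fin d)) :
    localSlope M (fun z => ∫ ω, f (φ z ω) ∂P) (r / c) z ≤
      ENNReal.ofReal c * ∫⁻ ω, localSlope M f r (φ z ω) ∂P := by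
  refine iSup₂_le fun y ⟨hpos, hyr⟩ => (slopeM_le_iff hpos).2 ?_
  rw [← integral_sub (hf z) (hf y), ← Real.enorm_eq_ofReal_abs, mul_right_comm,
    ← lintegral_const_mul' _ _ (by finiteness)]
  refine (enorm_integral_le_lintegral_enorm _).trans (lintegral_mono_ae ?_)
  filter_upwards [h z y] with ω hω
  have hscale : normM M (φ z ω - φ y ω) ≤ r := hω.trans ((le_div_iff₀' hc).1 hyr)
  calc ‖f (φ z ω) - f (φ y ω)‖ₑ
      ≤ localSlope M f r (φ z ω) * ENNReal.ofReal (normM M (φ z ω - φ y ω)) := by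
        rw [Real.enorm_eq_ofReal_abs]
        exact ofReal_abs_sub_le_localSlope_mul hM hscale
    _ ≤ localSlope M f r (φ z ω) * ENNReal.ofReal (c * normM M (z - y)) := by gcongr
    _ = ENNReal.ofReal c * ENNReal.ofReal (normM M (z - y)) * localSlope M f r (φ z ω) := by
        rw [ENNReal.ofReal_mul hc.le, mul_comm]

theorem lintegral_gradNorm_eq_iInf (hM : M.PosDef) {K : ℝ≥0} (hf : LipschitzWith K f)
    (μ : Measure (EuclideanSpace ℝ (Fin d))) [IsFiniteMeasure μ] :
    ∫⁻ x, gradNorm M f x ∂μ = ⨅ n : ℕ, ∫⁻ x, localSlope M f (1 / (n + 1)) x ∂μ := by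
  simp only [gradNorm_eq_iInf_nat]
  refine lintegral_iInf (fun n => measurable_localSlope M hf.continuous _)
    (fun m n hmn x => localSlope_mono M f x (Nat.one_div_le_one_div hmn))
    (ne_top_of_le_ne_top (b := gradNormSup M f * μ univ) ?_ ?_)
  · exact ENNReal.mul_ne_top (gradNormSup_ne_top hM hf) (measure_ne_top μ _)
  · rw [← lintegral_const]
    exact lintegral_mono fun x => localSlope_le_gradNormSup M f _ x

theorem gradNorm_integral_map_le [IsFiniteMeasure P] (hM : M.PosDef) (hφ : ∀ z, Measurable (φ z))
    (hc : 0 < c) (h : ∀ z y, ∀ᵐ ω ∂P, normM M (φ z ω - φ y ω) ≤ c * normM M (z - y))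
    (hf : IsBoundedLipschitz f) (z : EuclideanSpace ℝ (Fin d)) :
    gradNorm M (fun z => ∫ x, f x ∂P.map (φ z)) z ≤
      ENNReal.ofReal c * ∫⁻ x, gradNorm M f x ∂P.map (φ z) := by
  rw [lintegral_gradNorm_eq_iInf hM hf.2.choose_spec, ENNReal.mul_iInf (by simp)]
  refine le_iInf fun n => ?_
  have hn : (0 : ℝ) < 1 / (n + 1) := Nat.one_div_pos_of_nat
  simp only [integral_map (hφ _).aemeasurable hf.continuous.aestronglyMeasurable]
  rw [lintegral_map (measurable_localSlope M hf.continuous _) (hφ z)]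
  exact (gradNorm_le_localSlope M _ (div_pos hn hc) z).trans
    (localSlope_integral_le hM hc h (fun y => hf.integrable_comp (hφ y).aemeasurable) _ z)

theorem gradNormSup_integral_le_of_gradNorm_le (hM : M.PosDef)
    {κ : EuclideanSpace ℝ (Fin d) → Measure (EuclideanSpace ℝ (Fin d))}
    [∀ z, IsProbabilityMeasure (κ z)] {c : ℝ≥0∞}
    (h : ∀ z, gradNorm M (fun z => ∫ x, f x ∂κ z) z ≤ c * ∫⁻ x, gradNorm M f x ∂κ z) :
    gradNormSup M (fun z => ∫ x, f x ∂κ z) ≤ c * gradNormSup M f := by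
  refine gradNormSup_le_of_gradNorm_le hM fun z => (h z).trans ?_
  gcongr
  calc ∫⁻ x, gradNorm M f x ∂κ z ≤ ∫⁻ _, gradNormSup M f ∂κ z :=
        lintegral_mono fun x => gradNorm_le_gradNormSup M f x
    _ = gradNormSup M f := by simp

end RandomMap

section MeanDisplacement

/-- The truncation of `a` to the interval `[-R, R]`. -/
def truncate (R a : ℝ) : ℝ :=
  max (min a R) (-R)

theorem abs_truncate_sub_truncate_le (R a a' : ℝ) : |truncate R a - truncate R a'| ≤ |a - a'| :=
  (abs_max_sub_max_le_abs _ _ _).trans (abs_inf_sub_inf_le_abs _ _ _)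

theorem abs_truncate_le {R : ℝ} (hR : 0 ≤ R) (a : ℝ) : |truncate R a| ≤ R :=
  abs_le.2 ⟨le_max_right _ _, max_le (min_le_right _ _) (by linarith)⟩

theorem truncate_of_abs_le {R a : ℝ} (h : |a| ≤ R) : truncate R a = a := by
  rw [truncate, min_eq_left (abs_le.1 h).2, max_eq_left (abs_le.1 h).1]

theorem tendsto_truncate_atTop (a : ℝ) : Tendsto (fun n : ℕ => truncate n a) atTop (𝓝 a) := by
  refine tendsto_const_nhds.congr' ?_
  filter_upwards [tendsto_natCast_atTop_atTop.eventually_ge_atTop |a|] with n hn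
  exact (truncate_of_abs_le hn).symm

variable {Ω : Type*} [MeasurableSpace Ω] {P : Measure Ω} {d : ℕ} {M : Matrix (Fin d) (Fin d) ℝ}
  {φ : EuclideanSpace ℝ (Fin d) → Ω → EuclideanSpace ℝ (Fin d)}
  {f : EuclideanSpace ℝ (Fin d) → ℝ} {c L : ℝ}

theorem isBoundedLipschitz_truncate {K : ℝ≥0} (hf : LipschitzWith K f) {R : ℝ} (hR : 0 ≤ R) :
    IsBoundedLipschitz fun x => truncate R (f x) :=
  ⟨⟨R, fun x => abs_truncate_le hR (f x)⟩, K, LipschitzWith.of_dist_le_mul fun x y =>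
    (abs_truncate_sub_truncate_le R (f x) (f y)).trans (hf.dist_le_mul x y)⟩

theorem abs_integral_truncate_sub_le [IsFiniteMeasure P] (hM : M.PosDef)
    (hφ : ∀ z, Measurable (φ z)) (hc : 0 ≤ c)
    (h : ∀ f, IsBoundedLipschitz f →
      gradNormSup M (fun z => ∫ x, f x ∂P.map (φ z)) ≤ ENNReal.ofReal c * gradNormSup M f)
    {K : ℝ≥0} (hf : LipschitzWith K f) (hL : 0 ≤ L)
    (hfL : ∀ x y, |f x - f y| ≤ L * normM M (x - y)) {R : ℝ} (hR : 0 ≤ R)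
    (z y : EuclideanSpace ℝ (Fin d)) :
    |∫ ω, (truncate R (f (φ z ω)) - truncate R (f (φ y ω))) ∂P| ≤ c * L * normM M (z - y) := by
  have hR := isBoundedLipschitz_truncate hf hR
  have htrunc : gradNormSup M (fun x => truncate R (f x)) ≤ ENNReal.ofReal L :=
    (gradNormSup_le_ofReal_iff hM hL).2 fun x y =>
      (abs_truncate_sub_truncate_le R (f x) (f y)).trans (hfL x y)
  have hsemigroup := (h _ hR).trans (mul_le_mul_right htrunc _)
  rw [← ENNReal.ofReal_mul hc, gradNormSup_le_ofReal_iff hM (mul_nonneg hc hL)] at hsemigroup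
  rw [integral_sub (hR.integrable_comp (hφ z).aemeasurable)
    (hR.integrable_comp (hφ y).aemeasurable)]
  simpa only [integral_map (hφ _).aemeasurable hR.continuous.aestronglyMeasurable] using
    hsemigroup z y

theorem abs_integral_sub_le_of_gradNormSup_le [IsFiniteMeasure P] (hM : M.PosDef)
    (hφ : ∀ z, Measurable (φ z)) (hc : 0 ≤ c)
    (h : ∀ f, IsBoundedLipschitz f →
      gradNormSup M (fun z => ∫ x, f x ∂P.map (φ z)) ≤ ENNReal.ofReal c * gradNormSup M f)
    {K : ℝ≥0} (hf : LipschitzWith K f) (hL : 0 ≤ L)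
    (hfL : ∀ x y, |f x - f y| ≤ L * normM M (x - y)) {z y : EuclideanSpace ℝ (Fin d)}
    (hinteg : Integrable (fun ω => φ z ω - φ y ω) P) :
    |∫ ω, (f (φ z ω) - f (φ y ω)) ∂P| ≤ c * L * normM M (z - y) := by
  refine le_of_tendsto' (tendsto_integral_of_dominated_convergence
    (F := fun n ω => truncate n (f (φ z ω)) - truncate n (f (φ y ω)))
    (fun ω => K * ‖φ z ω - φ y ω‖) (fun n => ?_) (hinteg.norm.const_mul _)
    (fun n => ae_of_all _ fun ω => ?_) (ae_of_all _ fun ω => ?_)).abs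
    fun n => abs_integral_truncate_sub_le hM hφ hc h hf hL hfL n.cast_nonneg z y
  · have hn := isBoundedLipschitz_truncate hf n.cast_nonneg
    exact ((hn.integrable_comp (hφ z).aemeasurable).sub
      (hn.integrable_comp (hφ y).aemeasurable)).aestronglyMeasurable
  · rw [← dist_eq_norm]
    exact (abs_truncate_sub_truncate_le n _ _).trans (hf.dist_le_mul _ _)
  · exact (tendsto_truncate_atTop _).sub (tendsto_truncate_atTop _)

-- Tested against `f = ⟪A m, A ·⟫`, where `A = √M` and `m` is the mean of `φ z - φ y`.
theorem normM_integral_sub_le_of_gradNormSup_le [IsFiniteMeasure P] (hM : M.PosDef)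
    (hφ : ∀ z, Measurable (φ z)) (hc : 0 ≤ c)
    (h : ∀ f, IsBoundedLipschitz f →
      gradNormSup M (fun z => ∫ x, f x ∂P.map (φ z)) ≤ ENNReal.ofReal c * gradNormSup M f)
    {z y : EuclideanSpace ℝ (Fin d)} (hinteg : Integrable (fun ω => φ z ω - φ y ω) P) :
    normM M (∫ ω, (φ z ω - φ y ω) ∂P) ≤ c * normM M (z - y) := by
  set m := ∫ ω, (φ z ω - φ y ω) ∂P
  let ℓ := (innerSL ℝ (sqrtMap M m)).comp (sqrtMap M)
  have hnorm := normM_eq_norm_sqrtMap hM.posSemidef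
  have hℓ : ∀ x y, |ℓ x - ℓ y| ≤ normM M m * normM M (x - y) := fun x y => by
    rw [← map_sub, hnorm, hnorm]
    exact abs_real_inner_le_norm (sqrtMap M m) (sqrtMap M (x - y))
  have hmean : ∫ ω, (ℓ (φ z ω) - ℓ (φ y ω)) ∂P = normM M m * normM M m := by
    simp only [← map_sub]
    rw [ℓ.integral_comp_comm hinteg, hnorm]
    exact real_inner_self_eq_norm_mul_norm (sqrtMap M m)
  have hle := abs_integral_sub_le_of_gradNormSup_le hM hφ hc h ℓ.lipschitz (normM_nonneg M m)
    hℓ hinteg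
  rw [hmean, abs_of_nonneg (mul_self_nonneg _)] at hle
  rcases (normM_nonneg M m).eq_or_lt with hzero | hpos
  · rw [← hzero]
    exact mul_nonneg hc (normM_nonneg M _)
  · exact le_of_mul_le_mul_left (by linarith) hpos

end MeanDisplacement

section Noise

theorem measurable_indicator_of_dense {Ω T E : Type*} [MeasurableSpace Ω] [TopologicalSpace T]
    [FrechetUrysohnSpace T] [TopologicalSpace E] [TopologicalSpace.PseudoMetrizableSpace E]
    [Zero E] [MeasurableSpace E] [BorelSpace E] {W : T → Ω → E} {G : Set Ω} {D : Set T}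
    (hD : Dense D) (hc : ∀ ω ∈ G, Continuous fun t => W t ω)
    (hm : ∀ q ∈ D, Measurable (G.indicator (W q))) (t : T) : Measurable (G.indicator (W t)) := by
  obtain ⟨u, huD, hut⟩ := mem_closure_iff_seq_limit.1 (hD t)
  refine measurable_of_tendsto_metrizable (fun n => hm (u n) (huD n))
    (tendsto_pi_nhds.2 fun ω => ?_)
  by_cases hω : ω ∈ G
  · simp only [indicator_of_mem hω]
    exact ((hc ω hω).tendsto t).comp hut
  · simp only [indicator_of_notMem hω, tendsto_const_nhds]

/-- `V` is a version of the process `W` that is measurable and all of whose paths are continuous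
and start at `0`. -/
structure IsContinuousVersion {Ω E : Type*} [MeasurableSpace Ω] [TopologicalSpace E] [Zero E]
    [MeasurableSpace E] (V W : ℝ≥0 → Ω → E) (P : Measure Ω) : Prop where
  measurable : ∀ t, Measurable (V t)
  continuous : ∀ ω, Continuous (V · ω)
  zero : ∀ ω, V 0 ω = 0
  ae_eq : ∀ᵐ ω ∂P, ∀ t, W t ω = V t ω

theorem exists_isContinuousVersion {Ω E : Type*} [MeasurableSpace Ω] {P : Measure Ω}
    [TopologicalSpace E] [TopologicalSpace.PseudoMetrizableSpace E] [Zero E] [MeasurableSpace E]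
    [BorelSpace E] {W : ℝ≥0 → Ω → E} (hm : ∀ t, AEMeasurable (W t) P)
    (hc : ∀ᵐ ω ∂P, Continuous (W · ω)) (h0 : ∀ᵐ ω ∂P, W 0 ω = 0) :
    ∃ V, IsContinuousVersion V W P := by
  obtain ⟨D, hDcount, hD⟩ := TopologicalSpace.exists_countable_dense ℝ≥0
  have hmk : ∀ᵐ ω ∂P, ∀ q ∈ D, W q ω = (hm q).mk (W q) ω :=
    (ae_ball_iff hDcount).2 fun q _ => (hm q).ae_eq_mk
  obtain ⟨G, hG, hGm, hGs⟩ := (hc.and (h0.and hmk)).exists_measurable_mem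
  have hindicator : ∀ q ∈ D, Measurable (G.indicator (W q)) := fun q hq => by
    rw [indicator_congr fun ω hω => (hGs ω hω).2.2 q hq]
    exact (hm q).measurable_mk.indicator hGm
  refine ⟨fun t => G.indicator (W t),
    measurable_indicator_of_dense hD (fun ω hω => (hGs ω hω).1) hindicator,
    fun ω => ?_, fun ω => indicator_apply_eq_zero.2 fun hω => (hGs ω hω).2.1, ?_⟩
  · by_cases hω : ω ∈ G
    · simpa only [indicator_of_mem hω] using (hGs ω hω).1
    · simpa only [indicator_of_notMem hω] using continuous_const
  · filter_upwards [hG] with ω hω t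
    rw [indicator_of_mem hω]

variable {Ω : Type*} [MeasurableSpace Ω] {P : Measure Ω}

theorem hasDerivWithinAt_integral_of_norm_sub_le {E : Type*} [NormedAddCommGroup E]
    [NormedSpace ℝ E] {F : ℝ → Ω → E} {F' : Ω → E} {B : Ω → ℝ} {a : ℝ}
    (hF : ∀ s, Integrable (F s) P) (hB : Integrable B P)
    (hle : ∀ᶠ s in 𝓝[>] a, ∀ᵐ ω ∂P, ‖F s ω - F a ω‖ ≤ B ω * (s - a))
    (hF' : ∀ᵐ ω ∂P, HasDerivWithinAt (F · ω) (F' ω) (Ici a) a) :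
    HasDerivWithinAt (fun s => ∫ ω, F s ω ∂P) (∫ ω, F' ω ∂P) (Ici a) a := by
  rw [← hasDerivWithinAt_Ioi_iff_Ici, hasDerivWithinAt_iff_tendsto_slope' self_notMem_Ioi]
  have hslope : slope (fun s => ∫ ω, F s ω ∂P) a = fun s => ∫ ω, slope (F · ω) a s ∂P := by
    ext1 s
    simp only [slope_def_module, integral_smul, integral_sub (hF s) (hF a)]
  rw [hslope]
  refine tendsto_integral_filter_of_dominated_convergence B (.of_forall fun s => ?_) ?_ hB ?_
  · simp only [slope_def_module]
    exact (((hF s).sub (hF a)).smul _).aestronglyMeasurable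
  · filter_upwards [hle, self_mem_nhdsWithin] with s hs (has : a < s)
    filter_upwards [hs] with ω hω
    have hpos : 0 < s - a := sub_pos.2 has
    rw [slope_def_module, norm_smul, norm_inv, Real.norm_of_nonneg hpos.le, inv_mul_le_iff₀ hpos,
      mul_comm]
    exact hω
  · filter_upwards [hF'] with ω hω
    exact (hasDerivWithinAt_iff_tendsto_slope' self_notMem_Ioi).1 hω.Ioi_of_Ici

variable {E : Type*} [NormedAddCommGroup E] [NormedSpace ℝ E] [CompleteSpace E]
  {b : E → E} {K : ℝ≥0}

theorem IsDrivenPath.norm_sub_sub_le (hb : LipschitzWith K b) {γ x₁ x₂ : ℝ≥0 → E} {z₁ z₂ : E}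
    (h₁ : IsDrivenPath b γ z₁ x₁) (h₂ : IsDrivenPath b γ z₂ x₂) (t : ℝ≥0) :
    ‖(x₁ t - x₂ t) - (z₁ - z₂)‖ ≤ K * (Real.exp (K * t) * ‖z₁ - z₂‖) * t := by
  rw [h₁.sub_eq hb.continuous h₂, add_sub_cancel_left]
  refine (intervalIntegral.norm_integral_le_of_norm_le_const
    (C := K * (Real.exp (K * t) * ‖z₁ - z₂‖)) fun s hs => ?_).trans_eq (by simp)
  rw [uIoc_of_le (NNReal.coe_nonneg t)] at hs
  have hst : s.toNNReal ≤ t := Real.toNNReal_le_iff_le_coe.2 hs.2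
  calc ‖b (x₁ s.toNNReal) - b (x₂ s.toNNReal)‖ ≤ K * ‖x₁ s.toNNReal - x₂ s.toNNReal‖ :=
        hb.norm_sub_le _ _
    _ ≤ K * (Real.exp (K * s.toNNReal) * ‖z₁ - z₂‖) := by
        gcongr
        exact h₁.norm_sub_le hb h₂ _
    _ ≤ K * (Real.exp (K * t) * ‖z₁ - z₂‖) := by gcongr

variable [MeasurableSpace E] [BorelSpace E] [SecondCountableTopology E]
  {Γ : ℝ≥0 → Ω → E}

theorem integrable_flow_sub [IsFiniteMeasure P] (hb : LipschitzWith K b)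
    (hΓc : ∀ ω, Continuous (Γ · ω)) (hΓm : ∀ t, Measurable (Γ t)) (z y : E) (t : ℝ≥0) :
    Integrable (fun ω => flow b (Γ · ω) z t - flow b (Γ · ω) y t) P :=
  .of_bound ((measurable_flow hb hΓc hΓm z t).sub
    (measurable_flow hb hΓc hΓm y t)).aestronglyMeasurable (Real.exp (K * t) * ‖z - y‖)
    (ae_of_all _ fun ω => (isDrivenPath_flow hb (hΓc ω) z).norm_sub_le hb
      (isDrivenPath_flow hb (hΓc ω) y) t)

theorem hasDerivWithinAt_integral_flow_sub [IsProbabilityMeasure P] (hb : LipschitzWith K b)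
    (hΓc : ∀ ω, Continuous (Γ · ω)) (hΓm : ∀ t, Measurable (Γ t)) (hΓ0 : ∀ ω, Γ 0 ω = 0)
    (z y : E) :
    HasDerivWithinAt (fun s : ℝ => ∫ ω,
      (flow b (Γ · ω) z s.toNNReal - flow b (Γ · ω) y s.toNNReal) ∂P) (b z - b y) (Ici 0) 0 := by
  have hpath := fun z ω => isDrivenPath_flow hb (hΓc ω) z
  have hzero : ∀ z ω, flow b (Γ · ω) z 0 = z := fun z ω => flow_zero b (hΓ0 ω) z
  have hderiv : ∀ ω, HasDerivWithinAt (fun s : ℝ => flow b (Γ · ω) z s.toNNReal -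
      flow b (Γ · ω) y s.toNNReal) (b z - b y) (Ici 0) 0 := fun ω => by
    simpa only [Real.toNNReal_zero, hzero] using
      (hpath z ω).hasDerivWithinAt_sub hb.continuous (hpath y ω) le_rfl
  have hle : ∀ᶠ s : ℝ in 𝓝[>] 0, ∀ᵐ ω ∂P, ‖(flow b (Γ · ω) z s.toNNReal -
      flow b (Γ · ω) y s.toNNReal) - (flow b (Γ · ω) z (0 : ℝ).toNNReal -
      flow b (Γ · ω) y (0 : ℝ).toNNReal)‖ ≤ K * (Real.exp K * ‖z - y‖) * (s - 0) := by
    filter_upwards [Ioc_mem_nhdsGT one_pos] with s hs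
    refine ae_of_all _ fun ω => ?_
    have hs1 : (K : ℝ) * s ≤ K := mul_le_of_le_one_right K.2 hs.2
    simp only [Real.toNNReal_zero, hzero]
    refine ((hpath z ω).norm_sub_sub_le hb (hpath y ω) s.toNNReal).trans ?_
    rw [Real.coe_toNNReal s hs.1.le, _root_.sub_zero]
    have := hs.1.le
    gcongr
  simpa using hasDerivWithinAt_integral_of_norm_sub_le
    (fun s => integrable_flow_sub hb hΓc hΓm z y s.toNNReal)
    (integrable_const _) hle (ae_of_all _ hderiv)

theorem oneSidedLipschitz_of_norm_integral_flow_sub_le [IsProbabilityMeasure P] {F : Type*}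
    [NormedAddCommGroup F] [InnerProductSpace ℝ F] {A : E →L[ℝ] F} {c : ℝ}
    (hb : LipschitzWith K b) (hΓc : ∀ ω, Continuous (Γ · ω)) (hΓm : ∀ t, Measurable (Γ t))
    (hΓ0 : ∀ ω, Γ 0 ω = 0)
    (h : ∀ (t : ℝ≥0) z y, ‖A (∫ ω, (flow b (Γ · ω) z t - flow b (Γ · ω) y t) ∂P)‖ ≤
      Real.exp (c * t) * ‖A (z - y)‖) : OneSidedLipschitz A c b := by
  intro z y
  have hderiv := A.hasFDerivAt.comp_hasDerivWithinAt (0 : ℝ)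
    (hasDerivWithinAt_integral_flow_sub (P := P) hb hΓc hΓm hΓ0 z y)
  have hflow0 : ∀ z ω, flow b (Γ · ω) z 0 = z := fun z ω => flow_zero b (hΓ0 ω) z
  have hzero : ∫ ω, (flow b (Γ · ω) z 0 - flow b (Γ · ω) y 0) ∂P = z - y := by
    simp [hflow0]
  have hle := inner_deriv_right_le_of_norm_le_exp_mul (c := c) hderiv fun t ht => by
    simpa [hzero, Real.coe_toNNReal t ht] using h t.toNNReal z y
  simpa [hzero] using hle

end Noise

section Diffusion

theorem IsAdmissibleDrift.exists_lipschitzWith {d : ℕ}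
    {b : EuclideanSpace ℝ (Fin d) → EuclideanSpace ℝ (Fin d)} (hb : IsAdmissibleDrift b) :
    ∃ K : ℝ≥0, LipschitzWith K b := by
  obtain ⟨C, hC⟩ := hb.bounded 1 le_rfl
  refine ⟨C.toNNReal, lipschitzWith_of_nnnorm_fderiv_le
    (hb.smooth.differentiable (by simp)) fun z => ?_⟩
  rw [← NNReal.coe_le_coe, coe_nnnorm, ← norm_iteratedFDeriv_one]
  exact (hC z).trans (Real.le_coe_toNNReal C)

variable {Ω : Type*} [MeasurableSpace Ω] {P : Measure Ω} {d : ℕ}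
  {W : ℝ≥0 → Ω → EuclideanSpace ℝ (Fin d)}

theorem IsBrownian.aemeasurable (hW : IsBrownian W P) (t : ℝ≥0) : AEMeasurable (W t) P :=
  (WithLp.measurable_toLp 2 _).comp_aemeasurable
    (aemeasurable_pi_lambda (fun ω i => W t ω i) fun i =>
      (hW.coord i).toIsPreBrownianReal.aemeasurable t)

theorem IsBrownian.ae_continuous (hW : IsBrownian W P) : ∀ᵐ ω ∂P, Continuous (W · ω) := by
  filter_upwards [ae_all_iff.2 fun i => (hW.coord i).cont] with ω hω
  exact (PiLp.continuous_toLp 2 _).comp (continuous_pi hω)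

theorem IsBrownian.ae_zero (hW : IsBrownian W P) : ∀ᵐ ω ∂P, W 0 ω = 0 := by
  filter_upwards [ae_all_iff.2 fun i => (hW.coord i).toIsPreBrownianReal.eval_zero_ae_eq_zero]
    with ω hω
  ext i
  simpa using hω i

theorem exists_isContinuousVersion_mulVec (S : Matrix (Fin d) (Fin d) ℝ)
    (hWm : ∀ t, AEMeasurable (W t) P) (hWc : ∀ᵐ ω ∂P, Continuous (W · ω))
    (hW0 : ∀ᵐ ω ∂P, W 0 ω = 0) :
    ∃ V, IsContinuousVersion V (fun t ω => WithLp.toLp 2 (S *ᵥ (W t ω).ofLp)) P := by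
  have hS : Continuous fun x : EuclideanSpace ℝ (Fin d) => WithLp.toLp 2 (S *ᵥ x.ofLp) := by
    fun_prop
  refine exists_isContinuousVersion (fun t => hS.measurable.comp_aemeasurable (hWm t)) ?_ ?_
  · filter_upwards [hWc] with ω hω using hS.comp hω
  · filter_upwards [hW0] with ω hω
    simp [hω]

variable {b : EuclideanSpace ℝ (Fin d) → EuclideanSpace ℝ (Fin d)} {K : ℝ≥0}
  {S : Matrix (Fin d) (Fin d) ℝ} {V : ℝ≥0 → Ω → EuclideanSpace ℝ (Fin d)}

theorem isSolution_flow
    (hV : IsContinuousVersion V (fun t ω => WithLp.toLp 2 (S *ᵥ (W t ω).ofLp)) P)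
    (hb : LipschitzWith K b) (z : EuclideanSpace ℝ (Fin d)) :
    IsSolution b S W P z fun t ω => flow b (V · ω) z t := by
  filter_upwards [hV.ae_eq] with ω hω
  have h := isDrivenPath_flow hb (hV.continuous ω) z
  simp only [← hω] at h ⊢
  exact h

theorem solution_ae_eq (hb : LipschitzWith K b) {z : EuclideanSpace ℝ (Fin d)}
    {Z : ℝ≥0 → Ω → EuclideanSpace ℝ (Fin d)} (hZ : IsSolution b S W P z Z) :
    ∀ᵐ ω ∂P, ∀ t, solution b S W z t ω = Z t ω := by
  filter_upwards [hZ] with ω hω t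
  have hex : ∃ x, IsPathSolution b S (fun t => W t ω) z x := ⟨_, hω⟩
  rw [solution, dif_pos hex]
  exact congrFun (IsDrivenPath.eq hb hex.choose_spec hω) t

theorem transition_eq_map (hb : LipschitzWith K b)
    {Z : EuclideanSpace ℝ (Fin d) → ℝ≥0 → Ω → EuclideanSpace ℝ (Fin d)}
    (hZ : ∀ z, IsSolution b S W P z (Z z)) (t : ℝ≥0) :
    transition b S W P t = fun z => P.map (Z z t) :=
  funext fun z => Measure.map_congr ((solution_ae_eq hb (hZ z)).mono fun _ hω => hω t)

theorem ContR.ae_normM_sub_le {M : Matrix (Fin d) (Fin d) ℝ} {ρ : ℝ} (h : ContR b M ρ)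
    (hM : M.PosSemidef) (hb : Differentiable ℝ b) {z₁ z₂ : EuclideanSpace ℝ (Fin d)}
    {Z₁ Z₂ : ℝ≥0 → Ω → EuclideanSpace ℝ (Fin d)} (h₁ : IsSolution b S W P z₁ Z₁)
    (h₂ : IsSolution b S W P z₂ Z₂) :
    ∀ᵐ ω ∂P, ∀ t : ℝ≥0, normM M (Z₁ t ω - Z₂ t ω) ≤ Real.exp (-ρ * t) * normM M (z₁ - z₂) := by
  filter_upwards [h₁, h₂] with ω hω₁ hω₂ t
  simp only [normM_eq_norm_sqrtMap hM]
  exact ((contR_iff_oneSidedLipschitz hM hb).1 h).norm_sub_le hb.continuous hω₁ hω₂ t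

theorem contR_of_normM_integral_flow_sub_le [IsProbabilityMeasure P]
    {M : Matrix (Fin d) (Fin d) ℝ} {ρ : ℝ} (hM : M.PosSemidef) (hbK : LipschitzWith K b)
    (hb : Differentiable ℝ b) (hVc : ∀ ω, Continuous (V · ω)) (hVm : ∀ t, Measurable (V t))
    (hV0 : ∀ ω, V 0 ω = 0)
    (h : ∀ (t : ℝ≥0) z y, normM M (∫ ω, (flow b (V · ω) z t - flow b (V · ω) y t) ∂P) ≤
      Real.exp (-ρ * t) * normM M (z - y)) : ContR b M ρ := by
  refine (contR_iff_oneSidedLipschitz hM hb).2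
    (oneSidedLipschitz_of_norm_integral_flow_sub_le (P := P) hbK hVc hVm hV0 fun t z y => ?_)
  simpa only [normM_eq_norm_sqrtMap hM] using h t z y

end Diffusion

theorem theorem1_general {Ω : Type*} [MeasurableSpace Ω] (P : Measure Ω) [IsProbabilityMeasure P]
    (d : ℕ) (W : ℝ≥0 → Ω → EuclideanSpace ℝ (Fin d)) (hWm : ∀ t, AEMeasurable (W t) P)
    (hWc : ∀ᵐ ω ∂P, Continuous (W · ω)) (hW0 : ∀ᵐ ω ∂P, W 0 ω = 0)
    (b : EuclideanSpace ℝ (Fin d) → EuclideanSpace ℝ (Fin d)) {K : ℝ≥0}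
    (hbK : LipschitzWith K b) (hb : Differentiable ℝ b) (S : Matrix (Fin d) (Fin d) ℝ)
    (M : Matrix (Fin d) (Fin d) ℝ) (hM : M.PosDef) (ρ : ℝ) :
    List.TFAE [
      ContR b M ρ,
      ∀ (z₁ z₂ : EuclideanSpace ℝ (Fin d)) (Z₁ Z₂ : ℝ≥0 → Ω → EuclideanSpace ℝ (Fin d)),
        IsSolution b S W P z₁ Z₁ → IsSolution b S W P z₂ Z₂ →
          ∀ᵐ ω ∂P, ∀ t : ℝ≥0,
            normM M (Z₁ t ω - Z₂ t ω) ≤ Real.exp (-ρ * t) * normM M (z₁ - z₂),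
      ∀ (ν μ : Measure (EuclideanSpace ℝ (Fin d))) [IsProbabilityMeasure ν]
          [IsProbabilityMeasure μ] (t : ℝ≥0),
        wasserstein M ∞ (evolve b S W P t ν) (evolve b S W P t μ)
          ≤ ENNReal.ofReal (Real.exp (-ρ * t)) * wasserstein M ∞ ν μ,
      ∀ (ν μ : Measure (EuclideanSpace ℝ (Fin d))) [IsProbabilityMeasure ν]
          [IsProbabilityMeasure μ] (t : ℝ≥0),
        wasserstein M 1 (evolve b S W P t ν) (evolve b S W P t μ)
          ≤ ENNReal.ofReal (Real.exp (-ρ * t)) * wasserstein M 1 ν μ,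
      ∀ f : EuclideanSpace ℝ (Fin d) → ℝ, IsBoundedLipschitz f →
        ∀ (t : ℝ≥0) (z : EuclideanSpace ℝ (Fin d)),
          gradNorm M (semigroup b S W P t f) z
            ≤ ENNReal.ofReal (Real.exp (-ρ * t)) * semigroupENN b S W P t (gradNorm M f) z,
      ∀ f : EuclideanSpace ℝ (Fin d) → ℝ, IsBoundedLipschitz f → ∀ t : ℝ≥0,
        gradNormSup M (semigroup b S W P t f)
          ≤ ENNReal.ofReal (Real.exp (-ρ * t)) * gradNormSup M f] := by
  obtain ⟨V, hV⟩ := exists_isContinuousVersion_mulVec S hWm hWc hW0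
  let φ (t : ℝ≥0) (z : EuclideanSpace ℝ (Fin d)) (ω : Ω) := flow b (V · ω) z t
  have hφ (t) : Measurable fun p : EuclideanSpace ℝ (Fin d) × Ω => φ t p.1 p.2 :=
    measurable_uncurry_flow hbK hV.continuous hV.measurable t
  have hφz (t z) : Measurable (φ t z) := (hφ t).comp measurable_prodMk_left
  have hκ (t) : Measurable fun z => P.map (φ t z) := measurable_map_of_measurable_uncurry (hφ t)
  have hprob (t z) : IsProbabilityMeasure (P.map (φ t z)) :=
    Measure.isProbabilityMeasure_map (hφz t z).aemeasurable
  have hsol := isSolution_flow hV hbK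
  have htransition (t) : transition b S W P t = fun z => P.map (φ t z) :=
    transition_eq_map hbK hsol t
  unfold evolve semigroup semigroupENN
  simp only [htransition]
  tfae_have 1 → 2 := fun h _ _ _ _ h₁ h₂ => h.ae_normM_sub_le hM.posSemidef hb h₁ h₂
  have hcontr (h : ∀ z₁ z₂ Z₁ Z₂, IsSolution b S W P z₁ Z₁ → IsSolution b S W P z₂ Z₂ →
      ∀ᵐ ω ∂P, ∀ t : ℝ≥0, normM M (Z₁ t ω - Z₂ t ω) ≤ Real.exp (-ρ * t) * normM M (z₁ - z₂))
      (t z y) : ∀ᵐ ω ∂P, normM M (φ t z ω - φ t y ω) ≤ Real.exp (-ρ * t) * normM M (z - y) :=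
    (h z y _ _ (hsol z) (hsol y)).mono fun _ hω => hω t
  tfae_have 2 → 3 := fun h ν μ _ _ t => wasserstein_bind_map_le (hφ t) (hcontr h t) ∞ ν μ
  tfae_have 2 → 4 := fun h ν μ _ _ t => wasserstein_bind_map_le (hφ t) (hcontr h t) 1 ν μ
  tfae_have 2 → 5 := fun h f hf t =>
    gradNorm_integral_map_le hM (hφz t) (Real.exp_pos _) (hcontr h t) hf
  tfae_have 5 → 6 := fun h f hf t => gradNormSup_integral_le_of_gradNorm_le hM (h f hf t)
  tfae_have 3 → 6 := fun h f hf t =>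
    gradNormSup_integral_le_of_wasserstein_bind_le hM (hκ t) le_top (fun ν μ _ _ => h ν μ t) hf
  tfae_have 4 → 6 := fun h f hf t =>
    gradNormSup_integral_le_of_wasserstein_bind_le hM (hκ t) le_rfl (fun ν μ _ _ => h ν μ t) hf
  tfae_have 6 → 1 := fun h =>
    contR_of_normM_integral_flow_sub_le (P := P) hM.posSemidef hbK hb hV.continuous hV.measurable
      hV.zero fun t z y => normM_integral_sub_le_of_gradNormSup_le hM (hφz t) (Real.exp_nonneg _)
        (fun f hf => h f hf t) (integrable_flow_sub hbK hV.continuous hV.measurable z y t)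
  tfae_finish

end DiffusionContraction

theorem theorem1 {Ω : Type*} [MeasurableSpace Ω] (P : Measure Ω) [IsProbabilityMeasure P]
    (d : ℕ) (W : ℝ≥0 → Ω → EuclideanSpace ℝ (Fin d)) (hW : IsBrownian W P)
    (b : EuclideanSpace ℝ (Fin d) → EuclideanSpace ℝ (Fin d)) (hb : IsAdmissibleDrift b)
    (S : Matrix (Fin d) (Fin d) ℝ) (hS : S.PosSemidef)
    (M : Matrix (Fin d) (Fin d) ℝ) (hM : M.PosDef) (ρ : ℝ) :
    List.TFAE [
      -- the deterministic condition on the drift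
      ContR b M ρ,
      -- contraction of the parallel coupling
      ∀ (z₁ z₂ : EuclideanSpace ℝ (Fin d)) (Z₁ Z₂ : ℝ≥0 → Ω → EuclideanSpace ℝ (Fin d)),
        IsSolution b S W P z₁ Z₁ → IsSolution b S W P z₂ Z₂ →
          ∀ᵐ ω ∂P, ∀ t : ℝ≥0,
            normM M (Z₁ t ω - Z₂ t ω) ≤ Real.exp (-ρ * t) * normM M (z₁ - z₂),
      -- contraction of the Wasserstein distance of infinite order
      ∀ (ν μ : Measure (EuclideanSpace ℝ (Fin d))) [IsProbabilityMeasure ν]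
          [IsProbabilityMeasure μ] (t : ℝ≥0),
        wasserstein M ∞ (evolve b S W P t ν) (evolve b S W P t μ)
          ≤ ENNReal.ofReal (Real.exp (-ρ * t)) * wasserstein M ∞ ν μ,
      -- contraction of the Wasserstein distance of order one
      ∀ (ν μ : Measure (EuclideanSpace ℝ (Fin d))) [IsProbabilityMeasure ν]
          [IsProbabilityMeasure μ] (t : ℝ≥0),
        wasserstein M 1 (evolve b S W P t ν) (evolve b S W P t μ)
          ≤ ENNReal.ofReal (Real.exp (-ρ * t)) * wasserstein M 1 ν μ,
      -- pointwise gradient bound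
      ∀ f : EuclideanSpace ℝ (Fin d) → ℝ, IsBoundedLipschitz f →
        ∀ (t : ℝ≥0) (z : EuclideanSpace ℝ (Fin d)),
          gradNorm M (semigroup b S W P t f) z
            ≤ ENNReal.ofReal (Real.exp (-ρ * t)) * semigroupENN b S W P t (gradNorm M f) z,
      -- bound on the Lipschitz constant
      ∀ f : EuclideanSpace ℝ (Fin d) → ℝ, IsBoundedLipschitz f → ∀ t : ℝ≥0,
        gradNormSup M (semigroup b S W P t f)
          ≤ ENNReal.ofReal (Real.exp (-ρ * t)) * gradNormSup M f] := by
  obtain ⟨K, hK⟩ := hb.exists_lipschitzWith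
  exact theorem1_general P d W hW.aemeasurable hW.ae_continuous hW.ae_zero b hK
    (hb.smooth.differentiable (by simp)) S M hM ρ
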